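/- Let $G=(V,E)$ be a finite graph with edge costs $c_e\ge 0$ and let $\mathcal F$ be a family of subsets of $V$ such that $E$ covers $\mathcal F$. Here an edge $e$ covers $S\subseteq V$ if exactly one end of $e$ is in $S$, and $J\subseteq E$ covers $\mathcal F$ if every $S\in\mathcal F$ is covered by some edge of $J$; the Set Family Edge Cover problem asks for a cover $J\subseteq E$ of $\mathcal F$ of minimum cost. For $J\subseteq E$ let $\mathcal F^J=\{S\in\mathcal F: \text{no edge of } J \text{ covers } S\}$ be the residual family; the cores of $\mathcal F^J$ are its inclusion-minimal members. The family $\mathcal F$ is accessed by queries that, given $J\subseteq E$, return all cores of $\mathcal F^J$. Two sets $A,B\subseteq V$ cross if $A\cap B$, $V\setminus(A\cup B)$, $A\setminus B$, $B\setminus A$ are all non-empty. The family $\mathcal F$ is - pliable if $\emptyset,V\notin\mathcal F$ and for all $A,B\in\mathcal F$ at least two of $A\cap B$, $A\cup B$, $A\setminus B$, $B\setminus A$ belong to $\mathcal F$; - $\gamma$-pliable if it is pliable and for all $J\subseteq E$ and all $S_1\subsetneq S_2$ in $\mathcal F^J$, if a core $C$ of $\mathcal F^J$ crosses both $S_1$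 and $S_2$, then $S_2\setminus(S_1\cup C)$ is empty or belongs to $\mathcal F^J$; - sparse if for every $J\subseteq E$, every $S\in\mathcal F^J$ crosses at most one core of $\mathcal F^J$; - $\beta$-crossing, for an integer $\beta\ge1$, if for every $J\subseteq E$, every core of $\mathcal F^J$ crosses at most $\beta$ pairwise disjoint sets of $\mathcal F^J$. The Williamson–Goemans–Mihail–Vazirani (WGMV) algorithm works as follows. Phase 1 starts with $J=\emptyset$ and $y=0$. While $\mathcal F^J$ has a core, it raises the dual variables $y_C$ of all cores $C$ of $\mathcal F^J$ uniformly (possibly by zero) until some edge $e\in E\setminus J$ that covers at least one of these cores becomes tight, i.e. $\sum_{S:\, e \text{ covers } S} y_S=c_e$, and adds one such $e$ to $J$ (ties are broken by an arbitrary fixed order of $E$). Phase 2 processes the edges of $J$ in the reverse of the order in which they were added, and deletes an edge from $J$ if the remaining edges still cover $\mathcal F$. **Theorem.** If $\mathcal F$ is $\gamma$-pliable and sparse, then the WGMV algorithm returns a cover of $\mathcal F$ of cost at most $6$ times the minimum cost of a cover of $\mathcal F$. If in addition $\mathcal F$ is $\beta$-crossing, then the cost is at most $6-\frac1{\beta+1}$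 times the minimum. The number of steps made by the algorithm, counting arithmetic operations and comparisons on numbers as one step each and a query for the cores of a residual family as $\tau$ steps, is bounded by a fixed polynomial in $|V|+|E|+\tau$. -/

import Mathlib

/-! ## Set families, cores, residual families -/

namespace SetFamilyCover

section Families

variable {V E : Type} [DecidableEq V]

/-- The (multi)graph on the node set `V` with edge set `E` is given by the two ends of every edge;
the order of the two ends is irrelevant. Parallel edges and loops are allowed.
The edge `e` covers `S`, that is `e ∈ δ(S)`, if exactly one of its ends is in `S`. -/
def Covers (ends : E → V × V) (e : E) (S : Finset V) : Prop :=
  ¬ ((ends e).1 ∈ S ↔ (ends e).2 ∈ S)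

instance (ends : E → V × V) (e : E) (S : Finset V) : Decidable (Covers ends e S) :=
  inferInstanceAs (Decidable (¬ _))

/-- The edge set `J` covers the family `F`: every member of `F` is covered by an edge of `J`. -/
def IsCover (ends : E → V × V) (F : Set (Finset V)) (J : Finset E) : Prop :=
  ∀ S ∈ F, ∃ e ∈ J, Covers ends e S

/-- The residual family of `F` with respect to `J`: the members of `F` that `J` does not cover. -/
def residual (ends : E → V × V) (F : Set (Finset V)) (J : Finset E) : Set (Finset V) :=
  {S | S ∈ F ∧ ∀ e ∈ J, ¬ Covers ends e S}

/-- The cores of a family are its inclusion-minimal members. -/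
def IsCore (G : Set (Finset V)) (C : Finset V) : Prop :=
  Minimal (fun S => S ∈ G) C

/-- Two node sets cross. -/
def Cross [Fintype V] (A B : Finset V) : Prop :=
  (A ∩ B).Nonempty ∧ (Finset.univ \ (A ∪ B)).Nonempty ∧ (A \ B).Nonempty ∧ (B \ A).Nonempty

/-- Pliable families: at least two of `A ∩ B`, `A ∪ B`, `A \ B`, `B \ A` are in the family. -/
def IsPliable [Fintype V] (F : Set (Finset V)) : Prop :=
  ∅ ∉ F ∧ Finset.univ ∉ F ∧
  ∀ A ∈ F, ∀ B ∈ F,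
    (A ∩ B ∈ F ∧ A ∪ B ∈ F) ∨ (A ∩ B ∈ F ∧ A \ B ∈ F) ∨ (A ∩ B ∈ F ∧ B \ A ∈ F) ∨
    (A ∪ B ∈ F ∧ A \ B ∈ F) ∨ (A ∪ B ∈ F ∧ B \ A ∈ F) ∨ (A \ B ∈ F ∧ B \ A ∈ F)

/-- Property (γ), for all sets `J` of edges of the graph. -/
def PropertyGamma [Fintype V] (ends : E → V × V) (F : Set (Finset V)) : Prop :=
  ∀ J : Finset E, ∀ S₁ ∈ residual ends F J, ∀ S₂ ∈ residual ends F J, S₁ ⊂ S₂ →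
    ∀ C, IsCore (residual ends F J) C → Cross C S₁ → Cross C S₂ →
      S₂ \ (S₁ ∪ C) = ∅ ∨ S₂ \ (S₁ ∪ C) ∈ residual ends F J

/-- `γ`-pliable families. -/
def IsGammaPliable [Fintype V] (ends : E → V × V) (F : Set (Finset V)) : Prop :=
  IsPliable F ∧ PropertyGamma ends F

/-- Sparse families: a member of a residual family crosses at most one core of it. -/
def IsSparse [Fintype V] (ends : E → V × V) (F : Set (Finset V)) : Prop :=
  ∀ J : Finset E, ∀ S ∈ residual ends F J,
    ∀ C₁ C₂, IsCore (residual ends F J) C₁ → IsCore (residual ends F J) C₂ →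
      Cross S C₁ → Cross S C₂ → C₁ = C₂

/-- `β`-crossing families: a core of a residual family crosses at most `β` pairwise disjoint
members of it. -/
def IsBetaCrossing [Fintype V] (ends : E → V × V) (F : Set (Finset V)) (β : ℕ) : Prop :=
  ∀ J : Finset E, ∀ C, IsCore (residual ends F J) C →
    ∀ D : Finset (Finset V), (∀ S ∈ D, S ∈ residual ends F J ∧ Cross C S) →
      (∀ S ∈ D, ∀ T ∈ D, S ≠ T → Disjoint S T) → D.card ≤ β

/-- `J` is a feasible solution of cost at most `ρ` times that of every feasible solution,
hence at most `ρ` times the optimum. -/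
def IsApproxSolution {K : Type} [Field K] [LinearOrder K] (ends : E → V × V) (c : E → K)
    (F : Set (Finset V)) (ρ : K) (J : Finset E) : Prop :=
  IsCover ends F J ∧ ∀ J' : Finset E, IsCover ends F J' → ∑ e ∈ J, c e ≤ ρ * ∑ e ∈ J', c e

/-- The family is accessed only through a procedure that, for a given edge set `J`, lists (without
repetition) the cores of the residual family with respect to `J`. -/
def IsCoreOracle (ends : E → V × V) (F : Set (Finset V))
    (cores : Finset E → List (Finset V)) : Prop :=
  ∀ J : Finset E, (cores J).Nodup ∧ ∀ C, C ∈ cores J ↔ IsCore (residual ends F J) C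

end Families

/-! ## Computations with a step count -/

/-- A value together with the number of elementary steps spent on computing it. -/
structure Timed (α : Type) where
  val : α
  time : ℕ

instance : Monad Timed where
  pure a := ⟨a, 0⟩
  bind x f := ⟨(f x.val).val, x.time + (f x.val).time⟩

/-- Spend `k` steps. -/
def tick (k : ℕ) : Timed Unit := ⟨(), k⟩

/-! ## The primal-dual algorithm of Williamson, Goemans, Mihail and Vazirani

Unit-cost model: an arithmetic operation or comparison on numbers, a test whether a node belongs to
a set, and an elementary list operation each cost one step. A query for the cores of a residual
family costs `τ` steps, in addition to the time for writing down the edge set. -/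

section Algorithm

variable {V E K : Type} [DecidableEq V] [DecidableEq E] [Field K] [LinearOrder K]

/-- Query for the cores of the residual family of the listed edge set. -/
def query (cores : Finset E → List (Finset V)) (τ : ℕ) (J : List E) : Timed (List (Finset V)) := do
  tick (J.length + τ)
  return cores J.toFinset

/-- The number of sets in the list that are covered by `e`. -/
def countCovered (ends : E → V × V) (e : E) : List (Finset V) → Timed ℕ
  | [] => do
    tick 1
    return 0
  | C :: l => do
    tick 5
    let k ← countCovered ends e l
    return if Covers ends e C then k + 1 else k

/-- Attach to every edge (given with its slack) the number of current cores it covers. -/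
def annotate (ends : E → V × V) (Cs : List (Finset V)) :
    List (E × K) → Timed (List (E × K × ℕ))
  | [] => do
    tick 1
    return []
  | (e, s) :: l => do
    tick 2
    let k ← countCovered ends e Cs
    let r ← annotate ends Cs l
    return (e, s, k) :: r

/-- The first edge that becomes tight when the duals of the current cores are raised uniformly
(an edge of slack `s` covering `k > 0` of them becomes tight after a raise by `s / k`), together
with the amount of the raise. Ties are broken by the order of the list. -/
def firstTight : List (E × K × ℕ) → Timed (Option (E × K))
  | [] => do
    tick 1
    return none
  | (e, s, k) :: l => do
    tick 5
    let r ← firstTight l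
    if k = 0 then
      return r
    else
      match r with
      | none => return some (e, s / (k : K))
      | some (f, ε) => return if s / (k : K) ≤ ε then some (e, s / (k : K)) else some (f, ε)

/-- Raise the duals of the current cores by `ε`, updating the slacks, and take out the edge `f`. -/
def raise (f : E) (ε : K) : List (E × K × ℕ) → Timed (List (E × K))
  | [] => do
    tick 1
    return []
  | (e, s, k) :: l => do
    tick 5
    let r ← raise f ε l
    return if e = f then r else (e, s - ε * (k : K)) :: r

/-- Phase 1, running for at most `fuel` iterations. `J` lists the edges picked so far, the latest
one first; `pool` holds the other edges `e` with their slacks `c_e - ∑ y_S`, the sum being over the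
sets `S` covered by `e`. -/
def phase1 (ends : E → V × V) (cores : Finset E → List (Finset V)) (τ : ℕ) :
    (fuel : ℕ) → (J : List E) → (pool : List (E × K)) → Timed (List E)
  | 0, J, _ => return J
  | fuel + 1, J, pool => do
    let Cs ← query cores τ J
    tick 3
    if Cs.isEmpty then
      return J
    else
      let ann ← annotate ends Cs pool
      match ← firstTight ann with
      | none => return J
      | some (e, ε) =>
        let pool' ← raise e ε ann
        phase1 ends cores τ fuel (e :: J) pool'

/-- Phase 2 (reverse delete): process the edges of the first list in its order, deleting an edge
if the remaining ones still cover the family; `kept` lists the processed edges that were kept. -/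
def phase2 (cores : Finset E → List (Finset V)) (τ : ℕ) :
    (todo : List E) → (kept : List E) → Timed (List E)
  | [], kept => return kept
  | e :: todo, kept => do
    let Cs ← query cores τ (kept ++ todo)
    tick 3
    if Cs.isEmpty then phase2 cores τ todo kept else phase2 cores τ todo (e :: kept)

/-- The whole algorithm, on the edges listed by `es`. At most one iteration per edge is made. -/
def wgmv (ends : E → V × V) (c : E → K) (cores : Finset E → List (Finset V)) (τ : ℕ)
    (es : List E) : Timed (List E) := do
  tick (2 * es.length + 1)
  let J ← phase1 ends cores τ es.length [] (es.map fun e => (e, c e))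
  phase2 cores τ J []

end Algorithm

end SetFamilyCover

open SetFamilyCover

/-!
The analysis is a local ratio argument on top of a degree bound for the cores.

*Local ratio.* In a round with picked edges `J`, the slack function is split into the part that is
consumed by the raise, `ε` times the number of cores covered by an edge, and the slack left over.
Every cover pays at least `ε` per core for the first part. The edges of the final solution `X`
outside `J` form an inclusion-minimal cover of the residual family, because reverse delete handles
them before all of `J`. So the ratio is `ρ` as soon as, for every residual family `G` and every
inclusion-minimal cover `I` of it, the degrees of the cores with respect to `I` sum up to at most
`ρ` times the number of cores (`phase1_spec`, `phase2_spec`).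

*Laminar witnesses.* Every `e ∈ I` has a witness in `G`, covered by `e` and by no other edge of `I`,
and for a pliable family the witnesses can be chosen laminar (`exists_laminar_witnesses`). With the
whole vertex set as its root, the laminar family is a tree, in which `e` joins its witness `w e` to
the parent: the inner end of `e` has `w e` as the smallest tree node containing it, and the outer
end the parent of `w e`.

*Counting* (`sum_degree_le_of_minimal_cover`). Call a tree node black if it is the smallest one
containing some core, and white otherwise. There are at most as many black nodes as cores. If a
core contains an element whose smallest tree node is white, then it crosses this node, and also the
parent if that is white. By sparsity, in each connected region of white nodes only one core is
involved, so an edge gets at most one charge from its white ends. Property (γ) says that a white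
node crossed by a core lies inside this core up to its child, if it has only one child and the core
crosses this, too. In a chain of crossed white nodes the edges in the middle therefore have both
ends in the core and do not count. A potential on the tree nodes (`5 - t` for black and for
uncrossed nodes, `4` or `3` for crossed white ones) turns this into a local inequality at every
white node (`sum_whiteCharge_children_le`), and summation gives the bound `6 - t` per black node, up
to an excess of `t` for each lowest crossed white node and a saving of `1` for each crossed white
node with a black parent. For `t = 0` this is the ratio `6`. The lowest crossed nodes of a white
region are pairwise disjoint sets crossed by one core, so if `G` is `β`-crossing there are at most
`β` of them in each region, and the saving pays for the excess with `t = 1 / (β + 1)`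
(`minCrossed_le_top`).
-/

namespace SetFamilyCover

/-! ### Cores and laminar witness families -/

section Witnesses

variable {V E : Type}

theorem exists_isCore_subset [Finite V] {G : Set (Finset V)} {S : Finset V} (hS : S ∈ G) :
    ∃ C, IsCore G C ∧ C ⊆ S := by
  have := Fintype.ofFinite V
  obtain ⟨C, hle, hC⟩ := exists_minimal_le_of_wellFoundedLT (fun S => S ∈ G) S hS
  exact ⟨C, hC, hle⟩

variable [DecidableEq V]

/-- Minimality excludes three of the four corner sets, and pliability asks for two of them. -/
theorem IsCore.disjoint [Fintype V] {G : Set (Finset V)} (hG : IsPliable G) {C D : Finset V}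
    (hC : IsCore G C) (hD : IsCore G D) (hne : C ≠ D) : Disjoint C D := by
  rw [Finset.disjoint_iff_inter_eq_empty]
  by_contra hcon
  obtain ⟨x, hx⟩ := Finset.nonempty_iff_ne_empty.2 hcon
  have h1 : C ∩ D ∉ G := fun h => hne <| by
    have a := hC.2 h Finset.inter_subset_left
    have b := hD.2 h Finset.inter_subset_right
    exact le_antisymm (fun y hy => (Finset.mem_inter.1 (a hy)).2)
      (fun y hy => (Finset.mem_inter.1 (b hy)).1)
  have h2 : C \ D ∉ G := fun h => by
    have := hC.2 h Finset.sdiff_subset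
    have := this (Finset.mem_inter.1 hx).1
    simp at this hx; tauto
  have h3 : D \ C ∉ G := fun h => by
    have := hD.2 h Finset.sdiff_subset
    have := this (Finset.mem_inter.1 hx).2
    simp at this hx; tauto
  have := hG.2.2 C hC.1 D hD.1
  tauto

/-- The remaining condition in the definition of crossing, that some node lies outside both sets,
comes for free: `C ∪ S` has to be in the family. -/
theorem IsCore.cross [Fintype V] {G : Set (Finset V)} (hG : IsPliable G) {C S : Finset V}
    (hC : IsCore G C) (hS : S ∈ G) (hi : (C ∩ S).Nonempty) (hn : ¬ C ⊆ S) : Cross C S := by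
  obtain ⟨x, hx⟩ := hi
  obtain ⟨y, hyC, hyS⟩ := Finset.not_subset.1 hn
  have h1 : C ∩ S ∉ G := fun h => hn fun z hz =>
    (Finset.mem_inter.1 (hC.2 h Finset.inter_subset_left hz)).2
  have h2 : C \ S ∉ G := fun h => by
    have := hC.2 h Finset.sdiff_subset (Finset.mem_inter.1 hx).1
    simp at this hx; tauto
  have h3 : C ∪ S ∈ G := by
    have := hG.2.2 C hC.1 S hS
    tauto
  refine ⟨⟨x, hx⟩, ?_, ⟨y, by simp [hyC, hyS]⟩, ?_⟩
  · rw [Finset.sdiff_nonempty]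
    intro h
    exact hG.2.1 (Finset.univ_subset_iff.1 h ▸ h3)
  · rw [Finset.sdiff_nonempty]
    intro h
    exact hn (hC.2 hS h)

theorem IsPliable.residual [Fintype V] {ends : E → V × V} {F : Set (Finset V)} (hF : IsPliable F)
    (J : Finset E) : IsPliable (residual ends F J) := by
  refine ⟨fun h => hF.1 h.1, fun h => hF.2.1 h.1, fun A hA B hB => ?_⟩
  have key : ∀ e ∈ J, ¬ Covers ends e A ∧ ¬ Covers ends e B := fun e he => ⟨hA.2 e he, hB.2 e he⟩
  have h1 : A ∩ B ∈ F → A ∩ B ∈ SetFamilyCover.residual ends F J := fun h => ⟨h, fun e he => by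
    have := key e he; simp only [Covers, Finset.mem_inter] at *; tauto⟩
  have h2 : A ∪ B ∈ F → A ∪ B ∈ SetFamilyCover.residual ends F J := fun h => ⟨h, fun e he => by
    have := key e he; simp only [Covers, Finset.mem_union] at *; tauto⟩
  have h3 : A \ B ∈ F → A \ B ∈ SetFamilyCover.residual ends F J := fun h => ⟨h, fun e he => by
    have := key e he; simp only [Covers, Finset.mem_sdiff] at *; tauto⟩
  have h4 : B \ A ∈ F → B \ A ∈ SetFamilyCover.residual ends F J := fun h => ⟨h, fun e he => by
    have := key e he; simp only [Covers, Finset.mem_sdiff] at *; tauto⟩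
  have := hF.2.2 A hA.1 B hB.1
  tauto

theorem Cross.symm [Fintype V] {A B : Finset V} (h : Cross A B) : Cross B A :=
  ⟨Finset.inter_comm A B ▸ h.1, Finset.union_comm A B ▸ h.2.1, h.2.2.2, h.2.2.1⟩

/-- Two sets overlap if they are neither disjoint nor nested. -/
def Overlap (A B : Finset V) : Prop :=
  (A ∩ B).Nonempty ∧ (A \ B).Nonempty ∧ (B \ A).Nonempty

theorem Overlap.symm {A B : Finset V} (h : Overlap A B) : Overlap B A :=
  ⟨Finset.inter_comm A B ▸ h.1, h.2.2, h.2.1⟩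

theorem not_overlap_iff {A B : Finset V} : ¬ Overlap A B ↔ Disjoint A B ∨ A ⊆ B ∨ B ⊆ A := by
  simp only [Overlap, Finset.sdiff_nonempty, Finset.not_disjoint_iff_nonempty_inter.symm]
  tauto

/-- A corner of `A` and `B` is one of the four sets which pliability is about. -/
def IsCorner (A B X : Finset V) : Prop :=
  X = A ∩ B ∨ X = A ∪ B ∨ X = A \ B ∨ X = B \ A

theorem IsCorner.not_overlap {A B X : Finset V} (h : IsCorner A B X) :
    ¬ Overlap X A ∧ ¬ Overlap X B := by
  simp only [not_overlap_iff, Finset.disjoint_left, Finset.subset_iff]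
  rcases h with rfl | rfl | rfl | rfl <;> simp only [Finset.mem_inter, Finset.mem_union,
    Finset.mem_sdiff] <;> grind

theorem IsCorner.overlap {A B X T : Finset V} (hAB : Overlap A B) (h : IsCorner A B X)
    (hT : Overlap X T) : Overlap A T ∨ Overlap B T := by
  obtain ⟨⟨a, ha⟩, ⟨b, hb⟩, ⟨c, hc⟩⟩ := hAB
  by_contra hcon
  rw [not_or, not_overlap_iff, not_overlap_iff] at hcon
  revert hT
  rw [imp_false, not_overlap_iff]
  simp only [Finset.disjoint_left, Finset.subset_iff] at *
  rcases h with rfl | rfl | rfl | rfl <;> simp only [Finset.mem_inter, Finset.mem_union,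
    Finset.mem_sdiff] at * <;> grind

/-- `S` is a witness that `e` is needed in the edge set `I`: it is a member of the family that `e`
covers and no other edge of `I` covers. -/
def IsWitness (ends : E → V × V) (G : Set (Finset V)) (I : Finset E) (e : E) (S : Finset V) :
    Prop :=
  S ∈ G ∧ ∀ f ∈ I, Covers ends f S ↔ f = e

/-- A corner in the family is covered, and only `e` and `f` can cover it. -/
theorem IsWitness.corner {ends : E → V × V} {G : Set (Finset V)} {I : Finset E}
    (hI : IsCover ends G I) {e f : E} {A B X : Finset V}
    (hA : IsWitness ends G I e A) (hB : IsWitness ends G I f B) (hX : IsCorner A B X)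
    (hXG : X ∈ G) (hf : ¬ Covers ends f X) : IsWitness ends G I e X := by
  have key : ∀ g ∈ I, Covers ends g X → g = e := by
    intro g hg hgX
    have hge : Covers ends g A ∨ Covers ends g B := by
      simp only [Covers] at *
      rcases hX with rfl | rfl | rfl | rfl <;> simp only [Finset.mem_inter, Finset.mem_union,
        Finset.mem_sdiff] at * <;> tauto
    rcases hge with h | h
    · exact (hA.2 g hg).1 h
    · exact absurd ((hB.2 g hg).1 h ▸ hgX) hf
  refine ⟨hXG, fun g hg => ⟨key g hg, ?_⟩⟩
  rintro rfl
  obtain ⟨g', hg', hgX⟩ := hI X hXG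
  exact key g' hg' hgX ▸ hgX

theorem IsCorner.symm {A B X : Finset V} (h : IsCorner A B X) : IsCorner B A X := by
  rcases h with rfl | rfl | rfl | rfl
  · exact Or.inl (Finset.inter_comm _ _)
  · exact Or.inr (Or.inl (Finset.union_comm _ _))
  · exact Or.inr (Or.inr (Or.inr rfl))
  · exact Or.inr (Or.inr (Or.inl rfl))

/-- If `e` lies outside of `B`, then `e` covers neither of the corners inside `B`; so such a corner
is a witness for `f` as soon as it is in the family. -/
theorem uncross_outside [Fintype V] {ends : E → V × V} {G : Set (Finset V)} (hG : IsPliable G)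
    {I : Finset E} (hI : IsCover ends G I) {e f : E} (he : e ∈ I) (hf : f ∈ I) (hef : e ≠ f)
    {A B : Finset V} (hA : IsWitness ends G I e A) (hB : IsWitness ends G I f B)
    (hout : (ends e).1 ∉ B) :
    (∃ X, IsCorner A B X ∧ IsWitness ends G I e X) ∨
      ∃ X, IsCorner A B X ∧ X ⊆ B ∧ IsWitness ends G I f X := by
  have heB : ¬ Covers ends e B := fun h => hef ((hB.2 e he).1 h)
  have hfA : ¬ Covers ends f A := fun h => hef ((hA.2 f hf).1 h).symm
  have hfB : Covers ends f B := (hB.2 f hf).2 rfl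
  have c1 : IsCorner A B (A ∩ B) := Or.inl rfl
  have c2 : IsCorner A B (A ∪ B) := Or.inr (Or.inl rfl)
  have c3 : IsCorner A B (A \ B) := Or.inr (Or.inr (Or.inl rfl))
  have c4 : IsCorner A B (B \ A) := Or.inr (Or.inr (Or.inr rfl))
  by_cases h1 : A ∩ B ∈ G
  · exact Or.inr ⟨_, c1, Finset.inter_subset_right, hB.corner hI hA c1.symm h1 (by
      simp only [Covers, Finset.mem_inter] at *; tauto)⟩
  by_cases h4 : B \ A ∈ G
  · exact Or.inr ⟨_, c4, Finset.sdiff_subset, hB.corner hI hA c4.symm h4 (by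
      simp only [Covers, Finset.mem_sdiff] at *; tauto)⟩
  have h23 : A ∪ B ∈ G ∧ A \ B ∈ G := by
    have := hG.2.2 A hA.1 B hB.1
    tauto
  left
  -- `f` covers exactly one of the two corners outside `B`
  by_cases hc : Covers ends f (A ∪ B)
  · exact ⟨_, c3, hA.corner hI hB c3 h23.2 (by
      simp only [Covers, Finset.mem_sdiff, Finset.mem_union] at *; tauto)⟩
  · exact ⟨_, c2, hA.corner hI hB c2 h23.1 hc⟩

/-- If `e` lies inside `B`, then `e` covers neither of the corners outside `B`. -/
theorem uncross_inside [Fintype V] {ends : E → V × V} {G : Set (Finset V)} (hG : IsPliable G)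
    {I : Finset E} (hI : IsCover ends G I) {e f : E} (he : e ∈ I) (hf : f ∈ I) (hef : e ≠ f)
    {A B : Finset V} (hA : IsWitness ends G I e A) (hB : IsWitness ends G I f B)
    (hin : (ends e).1 ∈ B) :
    (∃ X, IsCorner A B X ∧ IsWitness ends G I e X) ∨
      ∃ X, IsCorner A B X ∧ (Disjoint X B ∨ B ⊆ X) ∧ IsWitness ends G I f X := by
  have heB : ¬ Covers ends e B := fun h => hef ((hB.2 e he).1 h)
  have hfA : ¬ Covers ends f A := fun h => hef ((hA.2 f hf).1 h).symm
  have hfB : Covers ends f B := (hB.2 f hf).2 rfl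
  have c1 : IsCorner A B (A ∩ B) := Or.inl rfl
  have c2 : IsCorner A B (A ∪ B) := Or.inr (Or.inl rfl)
  have c3 : IsCorner A B (A \ B) := Or.inr (Or.inr (Or.inl rfl))
  have c4 : IsCorner A B (B \ A) := Or.inr (Or.inr (Or.inr rfl))
  by_cases h2 : A ∪ B ∈ G
  · exact Or.inr ⟨_, c2, Or.inr Finset.subset_union_right, hB.corner hI hA c2.symm h2 (by
      simp only [Covers, Finset.mem_union] at *; tauto)⟩
  by_cases h3 : A \ B ∈ G
  · exact Or.inr ⟨_, c3, Or.inl Finset.sdiff_disjoint, hB.corner hI hA c3.symm h3 (by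
      simp only [Covers, Finset.mem_sdiff] at *; tauto)⟩
  have h14 : A ∩ B ∈ G ∧ B \ A ∈ G := by
    have := hG.2.2 A hA.1 B hB.1
    tauto
  left
  by_cases hc : Covers ends f (A ∩ B)
  · exact ⟨_, c4, hA.corner hI hB c4 h14.2 (by
      simp only [Covers, Finset.mem_sdiff, Finset.mem_inter] at *; tauto)⟩
  · exact ⟨_, c1, hA.corner hI hB c1 h14.1 hc⟩

/-- The uncrossing partner `B = w f` of a new witness `A` is chosen at the border of the laminar
family: among the sets overlapping `A` it is a minimal one if some minimal one does not contain `e`,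
and otherwise, all of them containing `e` and hence forming a chain, the largest one. -/
theorem exists_border [DecidableEq E] {ends : E → V × V} {e : E} {I' : Finset E}
    {w : E → Finset V} (hlam : ∀ f ∈ I', ∀ g ∈ I', ¬ Overlap (w f) (w g)) {A : Finset V}
    (hne : ∃ f ∈ I', Overlap A (w f)) :
    ∃ f ∈ I', Overlap A (w f) ∧
      (((ends e).1 ∉ w f ∧ ∀ g ∈ I', Overlap A (w g) → Disjoint (w f) (w g) ∨ w f ⊆ w g) ∨
        ((ends e).1 ∈ w f ∧ ∀ g ∈ I', Overlap A (w g) → w g ⊆ w f)) := by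
  classical
  by_cases hcase : ∀ f ∈ I', Overlap A (w f) → (ends e).1 ∈ w f
  · obtain ⟨f, hf, hmax⟩ := Finset.exists_max_image (I'.filter fun f => Overlap A (w f))
      (fun f => (w f).card) (by obtain ⟨f, hf⟩ := hne; exact ⟨f, by simpa using hf⟩)
    rw [Finset.mem_filter] at hf
    refine ⟨f, hf.1, hf.2, Or.inr ⟨hcase f hf.1 hf.2, fun g hg hgA => ?_⟩⟩
    rcases not_overlap_iff.1 (hlam g hg f hf.1) with h | h | h
    · exact absurd (hcase f hf.1 hf.2) (Finset.disjoint_left.1 h (hcase g hg hgA))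
    · exact h
    · exact (Finset.eq_of_subset_of_card_le h (hmax g (by simp [hg, hgA]))).ge
  · push Not at hcase
    obtain ⟨f₀, hf₀, hf₀A, hf₀e⟩ := hcase
    obtain ⟨f, hf, hmin⟩ := Finset.exists_min_image
      (I'.filter fun f => Overlap A (w f) ∧ (ends e).1 ∉ w f)
      (fun f => (w f).card) ⟨f₀, by simp [hf₀, hf₀A, hf₀e]⟩
    rw [Finset.mem_filter] at hf
    refine ⟨f, hf.1, hf.2.1, Or.inl ⟨hf.2.2, fun g hg hgA => ?_⟩⟩
    rcases not_overlap_iff.1 (hlam f hf.1 g hg) with h | h | h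
    · exact Or.inl h
    · exact Or.inr h
    · exact Or.inr (Finset.eq_of_subset_of_card_le h
        (hmin g (by simp [hg, hgA]; exact fun h' => hf.2.2 (h h')))).ge

/-- A laminar family of witnesses can be extended by one edge, by induction on the number of its
members that overlap the given witness `A` of the new edge (the set `D` bounds this number). In each
step `A` or its uncrossing partner `w f` is replaced by a corner, after which they no longer overlap,
and no new overlap arises. -/
theorem exists_laminar_insert [Fintype V] [DecidableEq E] {ends : E → V × V}
    {G : Set (Finset V)} (hG : IsPliable G) {I : Finset E} (hI : IsCover ends G I) {e : E}
    (he : e ∈ I) {I' : Finset E} (hI' : I' ⊆ I) (heI' : e ∉ I') (n : ℕ) :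
    ∀ (w : E → Finset V) (A : Finset V), (∀ f ∈ I', IsWitness ends G I f (w f)) →
      (∀ f ∈ I', ∀ g ∈ I', ¬ Overlap (w f) (w g)) → IsWitness ends G I e A →
      (∃ D : Finset E, D.card ≤ n ∧ ∀ f ∈ I', Overlap A (w f) → f ∈ D) →
      ∃ w' : E → Finset V, (∀ f ∈ insert e I', IsWitness ends G I f (w' f)) ∧
        ∀ f ∈ insert e I', ∀ g ∈ insert e I', ¬ Overlap (w' f) (w' g) := by
  have hself : ∀ S : Finset V, ¬ Overlap S S := fun S => not_overlap_iff.2 (Or.inr (Or.inl le_rfl))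
  induction n with
  | zero =>
    rintro w A hw hlam hA ⟨D, hD, hDA⟩
    have hD0 : D = ∅ := Finset.card_eq_zero.1 (Nat.le_zero.1 hD)
    have hno : ∀ f ∈ I', ¬ Overlap A (w f) := fun f hf h => by simpa [hD0] using hDA f hf h
    have hne : ∀ f ∈ I', f ≠ e := fun f hf h => heI' (h ▸ hf)
    refine ⟨Function.update w e A, ?_, ?_⟩
    · intro f hf
      rcases Finset.mem_insert.1 hf with rfl | hf
      · simpa using hA
      · simpa [hne f hf] using hw f hf
    · intro f hf g hg
      rcases Finset.mem_insert.1 hf with rfl | hf' <;> rcases Finset.mem_insert.1 hg with rfl | hg'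
      · exact hself _
      · simpa [hne g hg'] using hno g hg'
      · simpa [hne f hf'] using fun h => hno f hf' (Overlap.symm h)
      · simpa [hne f hf', hne g hg'] using hlam f hf' g hg'
  | succ n ih =>
    rintro w A hw hlam hA ⟨D, hD, hDA⟩
    by_cases hne : ∃ f ∈ I', Overlap A (w f)
    swap
    · push Not at hne
      exact ih w A hw hlam hA ⟨∅, by simp, fun f hf h => absurd h (hne f hf)⟩
    obtain ⟨f, hf, hAf, hborder⟩ := exists_border (ends := ends) (e := e) hlam hne
    have hef : e ≠ f := fun h => heI' (h ▸ hf)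
    have hDf : (D.erase f).card ≤ n := by
      have := Finset.card_erase_of_mem (hDA f hf hAf)
      omega
    -- either `A` is replaced by a corner, or `w f` is
    have key : (∃ X, IsCorner A (w f) X ∧ IsWitness ends G I e X) ∨
        ∃ X, IsCorner A (w f) X ∧ IsWitness ends G I f X ∧
          ∀ g ∈ I', Overlap A (w g) → ¬ Overlap X (w g) := by
      rcases hborder with ⟨hout, hb⟩ | ⟨hin, hb⟩
      · rcases uncross_outside hG hI he (hI' hf) hef hA (hw f hf) hout with h | ⟨X, hX, hXB, hXw⟩
        · exact Or.inl h
        · refine Or.inr ⟨X, hX, hXw, fun g hg hgA => not_overlap_iff.2 ?_⟩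
          rcases hb g hg hgA with h | h
          · exact Or.inl (Finset.disjoint_of_subset_left hXB h)
          · exact Or.inr (Or.inl (hXB.trans h))
      · rcases uncross_inside hG hI he (hI' hf) hef hA (hw f hf) hin with h | ⟨X, hX, hXB, hXw⟩
        · exact Or.inl h
        · refine Or.inr ⟨X, hX, hXw, fun g hg hgA => not_overlap_iff.2 ?_⟩
          rcases hXB with h | h
          · exact Or.inl (Finset.disjoint_of_subset_right (hb g hg hgA) h)
          · exact Or.inr (Or.inr ((hb g hg hgA).trans h))
    rcases key with ⟨X, hX, hXw⟩ | ⟨X, hX, hXw, hXn⟩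
    · refine ih w X hw hlam hXw ⟨D.erase f, hDf, fun g hg hgX => ?_⟩
      rcases hX.overlap hAf hgX with h | h
      · exact Finset.mem_erase.2 ⟨fun hgf => hX.not_overlap.2 (hgf ▸ hgX), hDA g hg h⟩
      · exact absurd h (hlam f hf g hg)
    · have hXg : ∀ g ∈ I', ¬ Overlap X (w g) := fun g hg hgX => by
        rcases hX.overlap hAf hgX with h | h
        · exact hXn g hg h hgX
        · exact hlam f hf g hg h
      refine ih (Function.update w f X) A ?_ ?_ hA ⟨D.erase f, hDf, ?_⟩
      · intro g hg
        by_cases hgf : g = f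
        · subst hgf; simpa using hXw
        · simpa [hgf] using hw g hg
      · intro g hg h hh
        by_cases hgf : g = f <;> by_cases hhf : h = f
        · subst hgf; subst hhf; exact hself _
        · subst hgf; simpa [hhf] using hXg h hh
        · subst hhf; simpa [hgf] using fun h' => hXg g hg (Overlap.symm h')
        · simpa [hgf, hhf] using hlam g hg h hh
      · intro g hg hgA
        by_cases hgf : g = f
        · subst hgf
          simp only [Function.update_self] at hgA
          exact absurd hgA.symm hX.not_overlap.1
        · simp only [Function.update_of_ne hgf] at hgA
          exact Finset.mem_erase.2 ⟨hgf, hDA g hg hgA⟩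

theorem exists_laminar_witnesses [Fintype V] [DecidableEq E] {ends : E → V × V}
    {G : Set (Finset V)} (hG : IsPliable G) {I : Finset E} (hI : IsCover ends G I)
    (hmin : ∀ e ∈ I, ∃ S, IsWitness ends G I e S) :
    ∃ w : E → Finset V, (∀ e ∈ I, IsWitness ends G I e (w e)) ∧
      ∀ e ∈ I, ∀ f ∈ I, ¬ Overlap (w e) (w f) := by
  suffices h : ∀ I' ⊆ I, ∃ w : E → Finset V, (∀ e ∈ I', IsWitness ends G I e (w e)) ∧
      ∀ e ∈ I', ∀ f ∈ I', ¬ Overlap (w e) (w f) from h I le_rfl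
  intro I' hI'
  induction I' using Finset.induction_on with
  | empty => exact ⟨fun _ => ∅, by simp⟩
  | insert e I' he ih =>
    obtain ⟨w, hw, hlam⟩ := ih ((Finset.subset_insert _ _).trans hI')
    obtain ⟨A, hA⟩ := hmin e (hI' (Finset.mem_insert_self _ _))
    exact exists_laminar_insert hG hI (hI' (Finset.mem_insert_self _ _))
      ((Finset.subset_insert _ _).trans hI') he I'.card w A hw hlam hA
      ⟨I', le_rfl, fun f hf _ => hf⟩

end Witnesses

/-! ### The tree of a laminar witness family -/

section WitnessTree

theorem ne_univ_of_ssubset {V : Type} [Fintype V] {M N : Finset V} (h : M ⊂ N) :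
    M ≠ Finset.univ := by
  rintro rfl
  exact h.2 (Finset.subset_univ _)

open scoped Classical

variable {V E : Type} [DecidableEq V]

/-- The end of `e` inside its witness. -/
def inner (ends : E → V × V) (w : E → Finset V) (e : E) : V :=
  if (ends e).1 ∈ w e then (ends e).1 else (ends e).2

/-- The end of `e` outside its witness. -/
def outer (ends : E → V × V) (w : E → Finset V) (e : E) : V :=
  if (ends e).1 ∈ w e then (ends e).2 else (ends e).1

theorem covers_iff_inner_outer (ends : E → V × V) (w : E → Finset V) (e : E) (S : Finset V) :
    Covers ends e S ↔ ¬ (inner ends w e ∈ S ↔ outer ends w e ∈ S) := by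
  unfold Covers inner outer
  split_ifs <;> tauto

variable [Fintype V]

/-- The nodes of the tree of a laminar family: its members and, as the root, the set of all
nodes of the graph. -/
def treeNodes (w : E → Finset V) (I : Finset E) : Finset (Finset V) :=
  insert Finset.univ (I.image w)

/-- The smallest tree node that contains `X`, given as the intersection of all of them. (It is a
tree node only for nonempty `X`.) -/
def hull (w : E → Finset V) (I : Finset E) (X : Finset V) : Finset V :=
  ((treeNodes w I).filter fun N => X ⊆ N).inf id

/-- The parent of the tree node `w e`, given as the smallest tree node that contains the outer end
of `e`. -/
def parent (ends : E → V × V) (w : E → Finset V) (I : Finset E) (e : E) : Finset V :=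
  hull w I {outer ends w e}

/-- A tree node is black if it is the smallest one containing some core, and white otherwise. -/
def IsBlack (G : Set (Finset V)) (w : E → Finset V) (I : Finset E) (N : Finset V) : Prop :=
  ∃ C, IsCore G C ∧ hull w I C = N

/-- Some core crosses `N`. -/
def IsCrossed (G : Set (Finset V)) (N : Finset V) : Prop :=
  ∃ C, IsCore G C ∧ Cross C N

/-- Some core that `e` covers contains an end of `e` for which the smallest tree node is white. -/
def HasWhiteEnd (ends : E → V × V) (G : Set (Finset V)) (w : E → Finset V) (I : Finset E) (e : E) :
    Prop :=
  ∃ C, IsCore G C ∧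
    ((inner ends w e ∈ C ∧ outer ends w e ∉ C ∧ ¬ IsBlack G w I (w e)) ∨
      (outer ends w e ∈ C ∧ inner ends w e ∉ C ∧ ¬ IsBlack G w I (parent ends w I e)))

/-- `N` has a single child, which is white and crossed. If `N` itself is white and crossed, then
property (γ) puts all of `N` outside this child into the crossing core. -/
def IsFull (ends : E → V × V) (G : Set (Finset V)) (w : E → Finset V) (I : Finset E)
    (N : Finset V) : Prop :=
  ∃ e ∈ I, parent ends w I e = N ∧ (∀ f ∈ I, parent ends w I f = N → f = e) ∧
    ¬ IsBlack G w I (w e) ∧ IsCrossed G (w e)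

/-- `N` is white and crossed, but none of its children is. -/
def IsMinCrossed (ends : E → V × V) (G : Set (Finset V)) (w : E → Finset V) (I : Finset E)
    (N : Finset V) : Prop :=
  ¬ IsBlack G w I N ∧ IsCrossed G N ∧
    ∀ e ∈ I, parent ends w I e = N → IsBlack G w I (w e) ∨ ¬ IsCrossed G (w e)

/-- The family `G` with an edge cover `I` and a laminar choice `w` of witnesses. -/
structure WitnessTree (ends : E → V × V) (G : Set (Finset V)) (I : Finset E) (w : E → Finset V) :
    Prop where
  pliable : IsPliable G
  witness : ∀ e ∈ I, IsWitness ends G I e (w e)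
  laminar : ∀ e ∈ I, ∀ f ∈ I, ¬ Overlap (w e) (w f)

variable {ends : E → V × V} {G : Set (Finset V)} {I : Finset E} {w : E → Finset V}

theorem subset_hull (X : Finset V) : X ⊆ hull w I X :=
  Finset.le_inf fun _ hN => (Finset.mem_filter.1 hN).2

theorem outer_mem_parent (e : E) : outer ends w e ∈ parent ends w I e :=
  subset_hull _ (by simp)

theorem hull_subset {X N : Finset V} (hN : N ∈ treeNodes w I) (h : X ⊆ N) : hull w I X ⊆ N :=
  Finset.inf_le (f := id) (Finset.mem_filter.2 ⟨hN, h⟩)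

theorem mem_treeNodes {N : Finset V} :
    N ∈ treeNodes w I ↔ N = Finset.univ ∨ ∃ e ∈ I, w e = N := by
  simp [treeNodes]

theorem mem_treeNodes_of_mem {e : E} (he : e ∈ I) : w e ∈ treeNodes w I :=
  mem_treeNodes.2 (Or.inr ⟨e, he, rfl⟩)

theorem exists_eq_of_mem_treeNodes {N : Finset V} (hN : N ∈ treeNodes w I)
    (h : N ≠ Finset.univ) : ∃ e ∈ I, w e = N :=
  (mem_treeNodes.1 hN).resolve_left h

theorem not_crossed_univ : ¬ IsCrossed G (Finset.univ : Finset V) := by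
  rintro ⟨C, -, -, ⟨x, hx⟩, -⟩
  simp at hx

namespace WitnessTree

variable (T : WitnessTree ends G I w)

include T

theorem mem {e : E} (he : e ∈ I) : w e ∈ G := (T.witness e he).1

theorem ne_univ {e : E} (he : e ∈ I) : w e ≠ Finset.univ := fun h => T.pliable.2.1 (h ▸ T.mem he)

theorem injOn : Set.InjOn w I := fun e he f hf h =>
  ((T.witness f hf).2 e he).1 (h ▸ ((T.witness e he).2 e he).2 rfl)

theorem inner_mem {e : E} (he : e ∈ I) : inner ends w e ∈ w e := by
  have := ((T.witness e he).2 e he).2 rfl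
  unfold Covers at this
  unfold inner
  split_ifs <;> tauto

theorem outer_notMem {e : E} (he : e ∈ I) : outer ends w e ∉ w e := by
  have := ((T.witness e he).2 e he).2 rfl
  unfold Covers at this
  unfold outer
  split_ifs <;> tauto

theorem inner_mem_iff {e f : E} (he : e ∈ I) (hf : f ∈ I) (h : e ≠ f) :
    inner ends w e ∈ w f ↔ outer ends w e ∈ w f := by
  have h1 := mt ((T.witness f hf).2 e he).1 h
  rwa [covers_iff_inner_outer ends w, not_not] at h1

theorem nested {M N : Finset V} (hM : M ∈ treeNodes w I) (hN : N ∈ treeNodes w I) :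
    Disjoint M N ∨ M ⊆ N ∨ N ⊆ M := by
  rcases mem_treeNodes.1 hM with rfl | ⟨e, he, rfl⟩
  · exact Or.inr (Or.inr (Finset.subset_univ _))
  rcases mem_treeNodes.1 hN with rfl | ⟨f, hf, rfl⟩
  · exact Or.inr (Or.inl (Finset.subset_univ _))
  exact not_overlap_iff.1 (T.laminar e he f hf)

theorem hull_mem {X : Finset V} (hX : X.Nonempty) : hull w I X ∈ treeNodes w I := by
  obtain ⟨x, hx⟩ := hX
  obtain ⟨N, hN, hmin⟩ := Finset.exists_min_image ((treeNodes w I).filter fun N => X ⊆ N)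
    Finset.card ⟨Finset.univ, by simp [treeNodes]⟩
  have hN' := Finset.mem_filter.1 hN
  have : hull w I X = N := by
    refine le_antisymm (hull_subset hN'.1 hN'.2) (Finset.le_inf fun M hM => ?_)
    have hM' := Finset.mem_filter.1 hM
    rcases T.nested hN'.1 hM'.1 with h | h | h
    · exact absurd (hM'.2 hx) (Finset.disjoint_left.1 h (hN'.2 hx))
    · exact h
    · exact (Finset.eq_of_subset_of_card_le h (hmin M hM)).ge
  exact this ▸ hN'.1

theorem hull_inner {e : E} (he : e ∈ I) : hull w I {inner ends w e} = w e := by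
  have hsub : hull w I {inner ends w e} ⊆ w e :=
    hull_subset (mem_treeNodes_of_mem he) (by simpa using T.inner_mem he)
  have hin : inner ends w e ∈ hull w I {inner ends w e} := subset_hull _ (by simp)
  rcases mem_treeNodes.1 (T.hull_mem (Finset.singleton_nonempty (inner ends w e))) with h |
    ⟨f, hf, h⟩
  · exact absurd (Finset.univ_subset_iff.1 (h ▸ hsub)) (T.ne_univ he)
  · by_cases hef : e = f
    · rw [← h, hef]
    · rw [← h] at hsub hin
      exact absurd (hsub ((T.inner_mem_iff he hf hef).1 hin)) (T.outer_notMem he)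

theorem parent_mem (e : E) : parent ends w I e ∈ treeNodes w I :=
  T.hull_mem (Finset.singleton_nonempty _)

theorem ssubset_parent {e : E} (he : e ∈ I) : w e ⊂ parent ends w I e := by
  have hout := outer_mem_parent (ends := ends) (w := w) (I := I) e
  refine ⟨?_, fun h => T.outer_notMem he (h hout)⟩
  rcases mem_treeNodes.1 (T.parent_mem e) with h | ⟨f, hf, h⟩
  · rw [h]; exact Finset.subset_univ _
  · rw [← h] at hout ⊢
    have hef : e ≠ f := by
      rintro rfl
      exact T.outer_notMem he hout
    rw [← T.hull_inner he]
    exact hull_subset (mem_treeNodes_of_mem hf) (by simpa using (T.inner_mem_iff he hf hef).2 hout)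

theorem parent_subset {e : E} (he : e ∈ I) {N : Finset V} (hN : N ∈ treeNodes w I)
    (h : w e ⊂ N) : parent ends w I e ⊆ N := by
  refine hull_subset hN (Finset.singleton_subset_iff.2 ?_)
  rcases mem_treeNodes.1 hN with rfl | ⟨f, hf, rfl⟩
  · exact Finset.mem_univ _
  · have hef : e ≠ f := by
      rintro rfl
      exact h.2 le_rfl
    exact (T.inner_mem_iff he hf hef).1 (h.1 (T.inner_mem he))

theorem exists_child {M N : Finset V} (hM : M ∈ treeNodes w I) (hN : N ∈ treeNodes w I)
    (h : M ⊂ N) : ∃ g ∈ I, parent ends w I g = N ∧ M ⊆ w g := by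
  obtain ⟨f, hf, rfl⟩ := exists_eq_of_mem_treeNodes hM (ne_univ_of_ssubset h)
  obtain ⟨g, hg, hmax⟩ := Finset.exists_max_image (I.filter fun g => w f ⊆ w g ∧ w g ⊂ N)
    (fun g => (w g).card) ⟨f, by simp [hf, h]⟩
  obtain ⟨hgI, hfg, hgN⟩ := Finset.mem_filter.1 hg
  refine ⟨g, hgI, ?_, hfg⟩
  by_contra hne
  have hss : parent ends w I g ⊂ N :=
    (T.parent_subset hgI hN hgN).ssubset_of_ne hne
  obtain ⟨k, hk, hkg⟩ := exists_eq_of_mem_treeNodes (T.parent_mem g) (ne_univ_of_ssubset hss)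
  have hgk := T.ssubset_parent hgI
  rw [← hkg] at hgk hss
  have := hmax k (Finset.mem_filter.2 ⟨hk, hfg.trans hgk.1, hss⟩)
  exact absurd (Finset.card_lt_card hgk) (not_lt.2 this)

theorem core_nonempty {C : Finset V} (hC : IsCore G C) : C.Nonempty :=
  Finset.nonempty_iff_ne_empty.2 fun h => T.pliable.1 (h ▸ hC.1)

/-- A white node of the tree contains a core, which lies in one of its children. -/
theorem exists_child_of_white {e : E} (he : e ∈ I) (hw : ¬ IsBlack G w I (w e)) :
    ∃ g ∈ I, parent ends w I g = w e := by
  obtain ⟨C, hC, hCe⟩ := exists_isCore_subset (T.mem he)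
  have hsub := hull_subset (mem_treeNodes_of_mem he) hCe
  obtain ⟨g, hg, hge, -⟩ := T.exists_child (T.hull_mem (T.core_nonempty hC))
    (mem_treeNodes_of_mem he) (hsub.ssubset_of_ne fun h => hw ⟨C, hC, h⟩)
  exact ⟨g, hg, hge⟩

/-- A core crosses every white tree node that is smallest for one of its elements. -/
theorem cross_of_mem {C : Finset V} (hC : IsCore G C) {x : V} (hx : x ∈ C)
    (hw : ¬ IsBlack G w I (hull w I {x})) : Cross C (hull w I {x}) := by
  have hn : ¬ C ⊆ hull w I {x} := fun h => hw ⟨C, hC, le_antisymm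
    (hull_subset (T.hull_mem (Finset.singleton_nonempty x)) h)
    (hull_subset (T.hull_mem (T.core_nonempty hC))
      (Finset.singleton_subset_iff.2 (subset_hull C hx)))⟩
  rcases mem_treeNodes.1 (T.hull_mem (Finset.singleton_nonempty x)) with h | ⟨f, hf, h⟩
  · exact absurd (h ▸ Finset.subset_univ C) hn
  · refine hC.cross T.pliable (h ▸ T.mem hf) ⟨x, Finset.mem_inter.2 ⟨hx, ?_⟩⟩ hn
    exact subset_hull _ (by simp)

/-- A core that crosses a tree node crosses its parent, too, if the parent is white. -/
theorem cross_parent {C : Finset V} (hC : IsCore G C) {e : E} (he : e ∈ I) (hx : Cross C (w e))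
    (hw : ¬ IsBlack G w I (parent ends w I e)) : Cross C (parent ends w I e) := by
  obtain ⟨⟨x, hx1⟩, -, hx2, -⟩ := hx
  rw [Finset.mem_inter] at hx1
  rw [Finset.sdiff_nonempty] at hx2
  have hss := T.ssubset_parent he
  have hn : ¬ C ⊆ parent ends w I e := fun h => by
    have hCm := T.hull_mem (T.core_nonempty hC)
    refine hw ⟨C, hC, le_antisymm (hull_subset (T.parent_mem e) h) ?_⟩
    rcases T.nested hCm (mem_treeNodes_of_mem he) with h' | h' | h'
    · exact absurd hx1.2 (Finset.disjoint_left.1 h' (subset_hull C hx1.1))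
    · exact absurd ((subset_hull C).trans h') hx2
    · exact T.parent_subset he hCm
        (h'.ssubset_of_ne fun h'' => hx2 (h'' ▸ subset_hull C))
  rcases mem_treeNodes.1 (T.parent_mem e) with h | ⟨f, hf, h⟩
  · exact absurd (h ▸ Finset.subset_univ C) hn
  · exact hC.cross T.pliable (h ▸ T.mem hf) ⟨x, Finset.mem_inter.2 ⟨hx1.1, hss.1 hx1.2⟩⟩ hn

/-- The only use of property (γ): the alternative would put a core into the white node `w n`
outside its only child. -/
theorem sdiff_subset_core
    (hγ : ∀ S₁ ∈ G, ∀ S₂ ∈ G, S₁ ⊂ S₂ → ∀ C, IsCore G C → Cross C S₁ → Cross C S₂ →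
      S₂ \ (S₁ ∪ C) = ∅ ∨ S₂ \ (S₁ ∪ C) ∈ G)
    {C : Finset V} (hC : IsCore G C) {n e : E} (hn : n ∈ I) (he : e ∈ I)
    (hp : parent ends w I e = w n) (huniq : ∀ f ∈ I, parent ends w I f = w n → f = e)
    (hw : ¬ IsBlack G w I (w n)) (hCn : Cross C (w n)) (hCe : Cross C (w e)) :
    w n \ w e ⊆ C := by
  have hss := T.ssubset_parent he
  rw [hp] at hss
  rcases hγ _ (T.mem he) _ (T.mem hn) hss C hC hCe hCn with h | h
  · intro x hx
    by_contra hxC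
    have : x ∈ w n \ (w e ∪ C) := by
      simp only [Finset.mem_sdiff, Finset.mem_union] at *
      tauto
    simp [h] at this
  · exfalso
    obtain ⟨D, hD, hDsub⟩ := exists_isCore_subset h
    obtain ⟨x, hx⟩ := T.core_nonempty hD
    have hDn : hull w I D ⊆ w n :=
      hull_subset (mem_treeNodes_of_mem hn) (hDsub.trans Finset.sdiff_subset)
    obtain ⟨g, hg, hgn, hDg⟩ := T.exists_child (T.hull_mem ⟨x, hx⟩) (mem_treeNodes_of_mem hn)
      (hDn.ssubset_of_ne fun h' => hw ⟨D, hD, h'⟩)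
    have h1 := hDg (subset_hull D hx)
    rw [huniq g hg hgn] at h1
    have h2 := hDsub hx
    simp only [Finset.mem_sdiff, Finset.mem_union] at h2
    tauto

theorem cross_of_inner_mem {C : Finset V} (hC : IsCore G C) {e : E} (he : e ∈ I)
    (hx : inner ends w e ∈ C) (hw : ¬ IsBlack G w I (w e)) : Cross C (w e) := by
  have := T.cross_of_mem hC hx
  rw [T.hull_inner he] at this
  exact this hw

theorem cross_of_outer_mem {C : Finset V} (hC : IsCore G C) {e : E}
    (hx : outer ends w e ∈ C) (hw : ¬ IsBlack G w I (parent ends w I e)) :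
    Cross C (parent ends w I e) :=
  T.cross_of_mem hC hx hw

/-- An edge covers at most one core through each of its ends, and if both ends are in white nodes
then at most one in total: by sparsity both cores would be the one that crosses the parent. -/
theorem card_covered_le
    (hsp : ∀ S ∈ G, ∀ C₁ C₂, IsCore G C₁ → IsCore G C₂ → Cross C₁ S → Cross C₂ S → C₁ = C₂)
    {Cs : Finset (Finset V)} (hCs : ∀ C, C ∈ Cs ↔ IsCore G C) {e : E} (he : e ∈ I) :
    (Cs.filter fun C => Covers ends e C).card ≤
      (if IsBlack G w I (w e) then 1 else 0) + (if IsBlack G w I (parent ends w I e) then 1 else 0)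
        + (if HasWhiteEnd ends G w I e then 1 else 0) := by
  set X := Cs.filter fun C => inner ends w e ∈ C ∧ outer ends w e ∉ C with hX
  set Y := Cs.filter fun C => outer ends w e ∈ C ∧ inner ends w e ∉ C with hY
  have hsplit : (Cs.filter fun C => Covers ends e C) ⊆ X ∪ Y := by
    intro C hC
    simp only [Finset.mem_filter, covers_iff_inner_outer ends w, hX, hY, Finset.mem_union]
      at hC ⊢
    tauto
  have hcard := (Finset.card_le_card hsplit).trans (Finset.card_union_le X Y)
  have huniq : ∀ (x : V) C D, C ∈ Cs → D ∈ Cs → x ∈ C → x ∈ D → C = D := by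
    intro x C D hC hD hxC hxD
    by_contra hne
    exact Finset.disjoint_left.1 (((hCs C).1 hC).disjoint T.pliable ((hCs D).1 hD) hne) hxC hxD
  have hX1 : X.card ≤ 1 := Finset.card_le_one.2 fun C hC D hD => by
    simp only [hX, Finset.mem_filter] at hC hD
    exact huniq _ C D hC.1 hD.1 hC.2.1 hD.2.1
  have hY1 : Y.card ≤ 1 := Finset.card_le_one.2 fun C hC D hD => by
    simp only [hY, Finset.mem_filter] at hC hD
    exact huniq _ C D hC.1 hD.1 hC.2.1 hD.2.1
  have hX2 : ¬ IsBlack G w I (w e) → ¬ HasWhiteEnd ends G w I e → X.card = 0 := by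
    intro hb hn
    rw [Finset.card_eq_zero, Finset.eq_empty_iff_forall_notMem]
    intro C hC
    simp only [hX, Finset.mem_filter] at hC
    exact hn ⟨C, (hCs C).1 hC.1, Or.inl ⟨hC.2.1, hC.2.2, hb⟩⟩
  have hY2 : ¬ IsBlack G w I (parent ends w I e) → ¬ HasWhiteEnd ends G w I e → Y.card = 0 := by
    intro hb hn
    rw [Finset.card_eq_zero, Finset.eq_empty_iff_forall_notMem]
    intro C hC
    simp only [hY, Finset.mem_filter] at hC
    exact hn ⟨C, (hCs C).1 hC.1, Or.inr ⟨hC.2.1, hC.2.2, hb⟩⟩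
  have hXY : ¬ IsBlack G w I (w e) → ¬ IsBlack G w I (parent ends w I e) →
      X.card = 0 ∨ Y.card = 0 := by
    intro hb hb'
    simp only [Finset.card_eq_zero]
    by_contra hcon
    rw [not_or, ← ne_eq, ← ne_eq, ← Finset.nonempty_iff_ne_empty,
      ← Finset.nonempty_iff_ne_empty] at hcon
    obtain ⟨⟨C, hC⟩, ⟨D, hD⟩⟩ := hcon
    simp only [hX, hY, Finset.mem_filter] at hC hD
    have hCc := (hCs C).1 hC.1
    have hDc := (hCs D).1 hD.1
    have h1 := T.cross_parent hCc he (T.cross_of_inner_mem hCc he hC.2.1 hb) hb'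
    have h2 := T.cross_of_outer_mem hDc hD.2.1 hb'
    rcases mem_treeNodes.1 (T.parent_mem e) with h | ⟨f, hf, h⟩
    · exact not_crossed_univ ⟨C, hCc, h ▸ h1⟩
    · rw [← h] at h1 h2
      exact hC.2.2 (hsp _ (T.mem hf) C D hCc hDc h1 h2 ▸ hD.2.1)
  split_ifs <;> first | omega | (have := hX2 ‹_› ‹_›; omega) | (have := hY2 ‹_› ‹_›; omega) |
    (have := hX2 ‹_› ‹_›; have := hY2 ‹_› ‹_›; omega) | (have := hXY ‹_› ‹_›; omega)

end WitnessTree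

end WitnessTree

/-! ### The degree bound -/

section Charging

open scoped Classical

variable {V E : Type} [Fintype V] [DecidableEq V]

/-- The potential of a tree node. The parameter `t` is the saving below the ratio `6`. -/
noncomputable def potential (ends : E → V × V) (G : Set (Finset V)) (w : E → Finset V)
    (I : Finset E) (t : ℝ) (N : Finset V) : ℝ :=
  if IsBlack G w I N ∨ ¬ IsCrossed G N then 5 - t else if IsFull ends G w I N then 3 else 4

/-- The number of white ends charged to `e`, at most one. -/
noncomputable def whiteCharge (ends : E → V × V) (G : Set (Finset V)) (w : E → Finset V)
    (I : Finset E) (e : E) : ℝ :=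
  if HasWhiteEnd ends G w I e then 1 else 0

/-- `e` joins a white crossed tree node to a black parent. -/
def IsTop (ends : E → V × V) (G : Set (Finset V)) (w : E → Finset V) (I : Finset E) (e : E) :
    Prop :=
  ¬ IsBlack G w I (w e) ∧ IsCrossed G (w e) ∧ IsBlack G w I (parent ends w I e)

variable {ends : E → V × V} {G : Set (Finset V)} {I : Finset E} {w : E → Finset V} {t : ℝ}

theorem three_le_potential (ht1 : t ≤ 1) (N : Finset V) : 3 ≤ potential ends G w I t N := by
  unfold potential
  split_ifs <;> linarith

theorem whiteCharge_le_one (e : E) : whiteCharge ends G w I e ≤ 1 := by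
  unfold whiteCharge
  split_ifs <;> norm_num

theorem whiteCharge_eq_zero {e : E} (h : ¬ HasWhiteEnd ends G w I e) :
    whiteCharge ends G w I e = 0 := if_neg h

namespace WitnessTree

variable (T : WitnessTree ends G I w)

include T

theorem crossed_of_hasWhiteEnd {e : E} (he : e ∈ I) (h : HasWhiteEnd ends G w I e)
    (hw : ¬ IsBlack G w I (parent ends w I e)) : IsCrossed G (parent ends w I e) := by
  obtain ⟨C, hC, h | h⟩ := h
  · exact ⟨C, hC, T.cross_parent hC he (T.cross_of_inner_mem hC he h.1 h.2.2) hw⟩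
  · exact ⟨C, hC, T.cross_of_outer_mem hC h.1 hw⟩

/-- If a white crossed node `w n` has a full white crossed node `w e` as its only child, then both
ends of `e` are in the crossing core, so no other core contains one of them. -/
theorem not_hasWhiteEnd_of_full
    (hγ : ∀ S₁ ∈ G, ∀ S₂ ∈ G, S₁ ⊂ S₂ → ∀ C, IsCore G C → Cross C S₁ → Cross C S₂ →
      S₂ \ (S₁ ∪ C) = ∅ ∨ S₂ \ (S₁ ∪ C) ∈ G)
    {n e : E} (hn : n ∈ I) (he : e ∈ I)
    (hp : parent ends w I e = w n) (huniq : ∀ f ∈ I, parent ends w I f = w n → f = e)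
    (hwn : ¬ IsBlack G w I (w n)) (hwe : ¬ IsBlack G w I (w e))
    (hfull : IsFull ends G w I (w e)) : ¬ HasWhiteEnd ends G w I e := by
  obtain ⟨k, hk, hke, hkuniq, hwk, C, hC, hCk⟩ := hfull
  have hCe : Cross C (w e) := hke ▸ T.cross_parent hC hk hCk (hke ▸ hwe)
  have hCn : Cross C (w n) := hp ▸ T.cross_parent hC he hCe (hp ▸ hwn)
  have h1 := T.sdiff_subset_core hγ hC hn he hp huniq hwn hCn hCe
  have h2 := T.sdiff_subset_core hγ hC he hk hke hkuniq hwe hCe hCk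
  have hout : outer ends w e ∈ C := h1 <| Finset.mem_sdiff.2
    ⟨hp ▸ outer_mem_parent e, T.outer_notMem he⟩
  have hin : inner ends w e ∈ C := h2 <| Finset.mem_sdiff.2 ⟨T.inner_mem he, fun h => by
    have := hull_subset (X := {inner ends w e}) (mem_treeNodes_of_mem hk) (by simpa using h)
    rw [T.hull_inner he] at this
    exact (hke ▸ T.ssubset_parent hk).2 this⟩
  rintro ⟨D, hD, h⟩
  by_cases hCD : C = D
  · subst hCD; tauto
  · have := hC.disjoint T.pliable hD hCD
    rcases h with h | h
    · exact Finset.disjoint_left.1 this hin h.1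
    · exact Finset.disjoint_left.1 this hout h.1

/-- The local inequality: at a white node the charges of the edges to its children are paid for by
the potential of the children minus that of the node, up to `t` at a lowest crossed node. -/
theorem sum_whiteCharge_children_le
    (hγ : ∀ S₁ ∈ G, ∀ S₂ ∈ G, S₁ ⊂ S₂ → ∀ C, IsCore G C → Cross C S₁ → Cross C S₂ →
      S₂ \ (S₁ ∪ C) = ∅ ∨ S₂ \ (S₁ ∪ C) ∈ G)
    (ht0 : 0 ≤ t) (ht1 : t ≤ 1) {n : E} (hn : n ∈ I) (hw : ¬ IsBlack G w I (w n)) :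
    ∑ e ∈ I.filter (fun e => parent ends w I e = w n),
        (whiteCharge ends G w I e - potential ends G w I t (w e)) ≤
      - potential ends G w I t (w n) + if IsMinCrossed ends G w I (w n) then t else 0 := by
  set ch := I.filter (fun e => parent ends w I e = w n) with hch
  obtain ⟨g, hg, hgn⟩ := T.exists_child_of_white hn hw
  have hgch : g ∈ ch := Finset.mem_filter.2 ⟨hg, hgn⟩
  have hterm : ∀ e ∈ ch, whiteCharge ends G w I e - potential ends G w I t (w e) ≤ -2 :=
    fun e _ => by
      linarith [whiteCharge_le_one (ends := ends) (G := G) (I := I) (w := w) e,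
        three_le_potential (ends := ends) (G := G) (I := I) (w := w) ht1 (w e)]
  have hif : 0 ≤ if IsMinCrossed ends G w I (w n) then t else 0 := by split_ifs <;> linarith
  by_cases hx : IsCrossed G (w n)
  swap
  · -- nothing is charged to the children of an uncrossed node
    have hpn : potential ends G w I t (w n) = 5 - t := if_pos (Or.inr hx)
    have hchild : ∀ e ∈ ch, whiteCharge ends G w I e - potential ends G w I t (w e) = -(5 - t) := by
      intro e he
      obtain ⟨heI, hen⟩ := Finset.mem_filter.1 he
      have h1 : ¬ HasWhiteEnd ends G w I e := fun h =>
        hx (hen ▸ T.crossed_of_hasWhiteEnd heI h (hen ▸ hw))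
      have h2 : IsBlack G w I (w e) ∨ ¬ IsCrossed G (w e) := by
        right
        rintro ⟨C, hC, hCe⟩
        exact hx ⟨C, hC, hen ▸ T.cross_parent hC heI hCe (hen ▸ hw)⟩
      rw [whiteCharge_eq_zero h1, potential, if_pos h2]
      ring
    rw [Finset.sum_congr rfl hchild, Finset.sum_const, nsmul_eq_mul, hpn]
    have hc : (1 : ℝ) ≤ ch.card := by exact_mod_cast Finset.card_pos.2 ⟨g, hgch⟩
    nlinarith
  · by_cases h1 : ∃ e, ch = {e}
    · obtain ⟨e, hce⟩ := h1
      have hee : e ∈ ch := by simp [hce]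
      obtain ⟨heI, hen⟩ := Finset.mem_filter.1 hee
      have huniq : ∀ f ∈ I, parent ends w I f = w n → f = e := fun f hf hfn => by
        have : f ∈ ch := Finset.mem_filter.2 ⟨hf, hfn⟩
        simpa [hce] using this
      rw [hce, Finset.sum_singleton]
      by_cases hce' : ¬ IsBlack G w I (w e) ∧ IsCrossed G (w e)
      · have hfull : IsFull ends G w I (w n) := ⟨e, heI, hen, huniq, hce'⟩
        have hpn : potential ends G w I t (w n) = 3 := by
          rw [potential, if_neg (by tauto), if_pos hfull]
        by_cases hfe : IsFull ends G w I (w e)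
        · have := T.not_hasWhiteEnd_of_full hγ hn heI hen huniq hw hce'.1 hfe
          rw [whiteCharge_eq_zero this, hpn]
          linarith [three_le_potential (ends := ends) (G := G) (I := I) (w := w) ht1 (w e)]
        · have hpe : potential ends G w I t (w e) = 4 := by
            rw [potential, if_neg (by tauto), if_neg hfe]
          rw [hpn, hpe]
          linarith [whiteCharge_le_one (ends := ends) (G := G) (I := I) (w := w) e]
      · have hpe : potential ends G w I t (w e) = 5 - t := by
          rw [potential, if_pos (by tauto)]
        have hm : IsMinCrossed ends G w I (w n) := ⟨hw, hx, fun f hf hfn => by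
          rw [huniq f hf hfn]
          tauto⟩
        have hfull : ¬ IsFull ends G w I (w n) := by
          rintro ⟨f, hf, hfn, -, h⟩
          rw [huniq f hf hfn] at h
          exact hce' h
        have hpn : potential ends G w I t (w n) = 4 := by
          rw [potential, if_neg (by tauto), if_neg hfull]
        rw [hpe, hpn, if_pos hm]
        linarith [whiteCharge_le_one (ends := ends) (G := G) (I := I) (w := w) e]
    · -- each of at least two children contributes at most `-2`, together at most `-4`
      have hfull : ¬ IsFull ends G w I (w n) := by
        rintro ⟨f, hf, hfn, huniq, -⟩
        refine h1 ⟨f, Finset.ext fun e => ?_⟩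
        simp only [hch, Finset.mem_filter, Finset.mem_singleton]
        exact ⟨fun h => huniq e h.1 h.2, fun h => h ▸ ⟨hf, hfn⟩⟩
      have hpn : potential ends G w I t (w n) = 4 := by
        rw [potential, if_neg (by tauto), if_neg hfull]
      have hc2 : 2 ≤ ch.card := by
        have h0 : ch.card ≠ 0 := Finset.card_ne_zero_of_mem hgch
        have h1' : ch.card ≠ 1 := fun h => h1 (Finset.card_eq_one.1 h)
        omega
      have hc : (2 : ℝ) ≤ ch.card := by exact_mod_cast hc2
      have := Finset.sum_le_card_nsmul ch _ (-2) hterm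
      rw [nsmul_eq_mul] at this
      rw [hpn]
      linarith

/-- Summation of the local inequalities over the tree. -/
theorem sum_whiteCharge_le
    (hγ : ∀ S₁ ∈ G, ∀ S₂ ∈ G, S₁ ⊂ S₂ → ∀ C, IsCore G C → Cross C S₁ → Cross C S₂ →
      S₂ \ (S₁ ∪ C) = ∅ ∨ S₂ \ (S₁ ∪ C) ∈ G)
    (ht0 : 0 ≤ t) (ht1 : t ≤ 1) :
    ∑ e ∈ I, (if IsBlack G w I (parent ends w I e) then 0 else
        whiteCharge ends G w I e - potential ends G w I t (w e)) ≤
      ∑ e ∈ I, if IsBlack G w I (w e) then 0 else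
        - potential ends G w I t (w e) + if IsMinCrossed ends G w I (w e) then t else 0 := by
  rw [← Finset.sum_fiberwise_of_maps_to (t := treeNodes w I) (g := fun e => parent ends w I e)
    (fun e _ => T.parent_mem e), treeNodes, Finset.sum_insert, Finset.sum_image T.injOn]
  swap
  · rw [Finset.mem_image]
    rintro ⟨e, he, h⟩
    exact T.ne_univ he h
  rw [← zero_add (∑ e ∈ I, if IsBlack G w I (w e) then _ else _)]
  refine add_le_add (Finset.sum_nonpos fun e _ => ?_) (Finset.sum_le_sum fun n hn => ?_)
  · split_ifs
    · exact le_rfl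
    · linarith [whiteCharge_le_one (ends := ends) (G := G) (I := I) (w := w) e,
        three_le_potential (ends := ends) (G := G) (I := I) (w := w) ht1 (w e)]
  · by_cases hw : IsBlack G w I (w n)
    · rw [if_pos hw]
      refine Finset.sum_nonpos fun e he => ?_
      rw [if_pos ((Finset.mem_filter.1 he).2 ▸ hw)]
    · rw [if_neg hw]
      refine le_trans (le_of_eq (Finset.sum_congr rfl fun e he => ?_))
        (T.sum_whiteCharge_children_le hγ ht0 ht1 hn hw)
      rw [if_neg ((Finset.mem_filter.1 he).2 ▸ hw)]

/-- Going up from a white crossed node through white nodes, all crossed by the same core, a node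
with a black parent is reached: the root is not crossed. -/
theorem exists_top (k : ℕ) : ∀ {e : E} {C : Finset V}, e ∈ I → ¬ IsBlack G w I (w e) →
    IsCore G C → Cross C (w e) → Fintype.card V - (w e).card ≤ k →
    ∃ f ∈ I, IsTop ends G w I f ∧ Cross C (w f) ∧ w e ⊆ w f ∧
      ∀ g ∈ I, w e ⊆ w g → w g ⊆ w f → ¬ IsBlack G w I (w g) ∧ IsCrossed G (w g) := by
  induction k with
  | zero =>
    intro e C he _ _ _ hk
    have := Finset.card_lt_univ_of_notMem (T.outer_notMem he)
    omega
  | succ k ih =>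
    intro e C he hw hC hCe hk
    by_cases hb : IsBlack G w I (parent ends w I e)
    · refine ⟨e, he, ⟨hw, ⟨C, hC, hCe⟩, hb⟩, hCe, le_rfl, fun g hg h1 h2 => ?_⟩
      rw [le_antisymm h2 h1]
      exact ⟨hw, C, hC, hCe⟩
    · have hCp := T.cross_parent hC he hCe hb
      obtain ⟨p, hp, hpe⟩ := exists_eq_of_mem_treeNodes (T.parent_mem (ends := ends) e)
        (fun h => not_crossed_univ ⟨C, hC, h ▸ hCp⟩)
      have hss := T.ssubset_parent he
      rw [← hpe] at hb hCp hss
      have hlt := Finset.card_lt_card hss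
      obtain ⟨f, hf, hft, hCf, hpf, hbet⟩ := ih hp hb hC hCp (by omega)
      refine ⟨f, hf, hft, hCf, hss.1.trans hpf, fun g hg h1 h2 => ?_⟩
      by_cases heq : w e = w g
      · rw [← heq]
        exact ⟨hw, C, hC, hCe⟩
      · refine hbet g hg ?_ h2
        rw [hpe]
        exact T.parent_subset he (mem_treeNodes_of_mem hg) (h1.ssubset_of_ne heq)

/-- The minimal crossed nodes below the same top are pairwise disjoint and crossed by the same
core, so there are at most `1 / t` of them. -/
theorem minCrossed_le_top
    (hsp : ∀ S ∈ G, ∀ C₁ C₂, IsCore G C₁ → IsCore G C₂ → Cross C₁ S → Cross C₂ S → C₁ = C₂)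
    (hβ : ∀ C, IsCore G C → ∀ D : Finset (Finset V), (∀ S ∈ D, S ∈ G ∧ Cross C S) →
      (∀ S ∈ D, ∀ S' ∈ D, S ≠ S' → Disjoint S S') → t * D.card ≤ 1) :
    t * (I.filter fun e => IsMinCrossed ends G w I (w e)).card ≤
      (I.filter fun e => IsTop ends G w I e).card := by
  have hex : ∀ e, ∃ f, e ∈ I → IsMinCrossed ends G w I (w e) →
      f ∈ I ∧ IsTop ends G w I f ∧ (∃ C, IsCore G C ∧ Cross C (w e) ∧ Cross C (w f)) ∧
      w e ⊆ w f ∧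
      ∀ g ∈ I, w e ⊆ w g → w g ⊆ w f → ¬ IsBlack G w I (w g) ∧ IsCrossed G (w g) := by
    intro e
    by_cases h : e ∈ I ∧ IsMinCrossed ends G w I (w e)
    · obtain ⟨he, hw, ⟨C, hC, hCe⟩, -⟩ := h
      obtain ⟨f, hf, h1, h2, h3, h4⟩ := T.exists_top _ he hw hC hCe le_rfl
      exact ⟨f, fun _ _ => ⟨hf, h1, ⟨C, hC, hCe, h2⟩, h3, h4⟩⟩
    · exact ⟨e, fun h1 h2 => absurd ⟨h1, h2⟩ h⟩
  choose top htop using hex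
  rw [Finset.card_eq_sum_card_fiberwise (f := top)
    (t := I.filter fun e => IsTop ends G w I e) (fun e he => by
      have he := Finset.mem_filter.1 (Finset.mem_coe.1 he)
      have := htop e he.1 he.2
      exact Finset.mem_coe.2 (Finset.mem_filter.2 ⟨this.1, this.2.1⟩)),
    Finset.cast_card (s := I.filter fun e => IsTop ends G w I e), Nat.cast_sum, Finset.mul_sum]
  refine Finset.sum_le_sum fun f hf => ?_
  obtain ⟨hfI, -⟩ := Finset.mem_filter.1 hf
  set B := (I.filter fun e => IsMinCrossed ends G w I (w e)).filter fun e => top e = f with hB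
  have hBmem : ∀ e ∈ B, e ∈ I ∧ IsMinCrossed ends G w I (w e) ∧
      (∃ C, IsCore G C ∧ Cross C (w e) ∧ Cross C (w f)) ∧ w e ⊆ w f ∧
      ∀ g ∈ I, w e ⊆ w g → w g ⊆ w f → ¬ IsBlack G w I (w g) ∧ IsCrossed G (w g) := by
    intro e he
    simp only [hB, Finset.mem_filter] at he
    have := htop e he.1.1 he.1.2
    rw [he.2] at this
    exact ⟨he.1.1, he.1.2, this.2.2⟩
  rcases B.eq_empty_or_nonempty with h0 | ⟨e₀, he₀⟩
  · simp [h0]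
  obtain ⟨-, -, ⟨C, hC, -, hCf⟩, -⟩ := hBmem e₀ he₀
  have hno : ∀ e ∈ B, ∀ e' ∈ B, ¬ w e ⊂ w e' := by
    intro e he e' he' hss
    obtain ⟨heI, -, -, -, hbet⟩ := hBmem e he
    obtain ⟨heI', hmin, -, hef', -⟩ := hBmem e' he'
    obtain ⟨g, hg, hgp, heg⟩ := T.exists_child (mem_treeNodes_of_mem heI)
      (mem_treeNodes_of_mem heI') hss
    have h1 := hbet g hg heg ((hgp ▸ T.ssubset_parent hg).1.trans hef')
    have h2 := hmin.2.2 g hg hgp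
    tauto
  have hinj : Set.InjOn w B := T.injOn.mono fun e he => (hBmem e he).1
  have := hβ C hC (B.image w) (by
    intro S hS
    obtain ⟨e, he, rfl⟩ := Finset.mem_image.1 hS
    obtain ⟨heI, -, ⟨D, hD, hDe, hDf⟩, -⟩ := hBmem e he
    exact ⟨T.mem heI, hsp _ (T.mem hfI) D C hD hC hDf hCf ▸ hDe⟩) (by
    intro S hS S' hS' hne
    obtain ⟨e, he, rfl⟩ := Finset.mem_image.1 hS
    obtain ⟨e', he', rfl⟩ := Finset.mem_image.1 hS'
    rcases not_overlap_iff.1 (T.laminar e (hBmem e he).1 e' (hBmem e' he').1) with h | h | h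
    · exact h
    · exact absurd (h.ssubset_of_ne hne) (hno e he e' he')
    · exact absurd (h.ssubset_of_ne hne.symm) (hno e' he' e he))
  rwa [Finset.card_image_of_injOn hinj] at this

theorem card_black_le {Cs : Finset (Finset V)} (hCs : ∀ C, C ∈ Cs ↔ IsCore G C) :
    (I.filter fun e => IsBlack G w I (w e)).card ≤ Cs.card := by
  rw [← Finset.card_image_of_injOn (f := w)
    (T.injOn.mono fun e he => (Finset.mem_filter.1 (Finset.mem_coe.1 he)).1)]
  refine le_trans (Finset.card_le_card ?_) (Finset.card_image_le (s := Cs) (f := hull w I))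
  intro N hN
  obtain ⟨e, he, rfl⟩ := Finset.mem_image.1 hN
  obtain ⟨C, hC, h⟩ := (Finset.mem_filter.1 he).2
  exact Finset.mem_image.2 ⟨C, (hCs C).2 hC, h⟩

theorem sum_degree_le
    (hγ : ∀ S₁ ∈ G, ∀ S₂ ∈ G, S₁ ⊂ S₂ → ∀ C, IsCore G C → Cross C S₁ → Cross C S₂ →
      S₂ \ (S₁ ∪ C) = ∅ ∨ S₂ \ (S₁ ∪ C) ∈ G)
    (hsp : ∀ S ∈ G, ∀ C₁ C₂, IsCore G C₁ → IsCore G C₂ → Cross C₁ S → Cross C₂ S → C₁ = C₂)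
    (ht0 : 0 ≤ t) (ht1 : t ≤ 1)
    (hβ : ∀ C, IsCore G C → ∀ D : Finset (Finset V), (∀ S ∈ D, S ∈ G ∧ Cross C S) →
      (∀ S ∈ D, ∀ S' ∈ D, S ≠ S' → Disjoint S S') → t * D.card ≤ 1)
    {Cs : Finset (Finset V)} (hCs : ∀ C, C ∈ Cs ↔ IsCore G C) :
    ((∑ e ∈ I, (Cs.filter fun C => Covers ends e C).card : ℕ) : ℝ) ≤ (6 - t) * Cs.card := by
  have h1 := T.sum_whiteCharge_le hγ ht0 ht1
  have h2 := T.minCrossed_le_top hsp hβ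
  have h3 : ((I.filter fun e => IsBlack G w I (w e)).card : ℝ) ≤ Cs.card := by
    exact_mod_cast T.card_black_le hCs
  -- the black ends of `e`, at most two, are paid for along with its white charge
  have hedge : ∀ e ∈ I, ((Cs.filter fun C => Covers ends e C).card : ℝ) ≤
      (6 - t) * (if IsBlack G w I (w e) then 1 else 0) +
      (if IsBlack G w I (parent ends w I e) then 0 else
        whiteCharge ends G w I e - potential ends G w I t (w e)) -
      (if IsBlack G w I (w e) then 0 else
        - potential ends G w I t (w e) + if IsMinCrossed ends G w I (w e) then t else 0) +
      t * (if IsMinCrossed ends G w I (w e) then 1 else 0) -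
      (if IsTop ends G w I e then 1 else 0) := by
    intro e he
    have hd : ((Cs.filter fun C => Covers ends e C).card : ℝ) ≤
        (if IsBlack G w I (w e) then 1 else 0) +
        (if IsBlack G w I (parent ends w I e) then 1 else 0) + whiteCharge ends G w I e := by
      unfold whiteCharge
      exact_mod_cast T.card_covered_le hsp hCs he
    refine hd.trans ?_
    have hle := whiteCharge_le_one (ends := ends) (G := G) (I := I) (w := w) e
    have hpot := three_le_potential (ends := ends) (G := G) (I := I) (w := w) ht1 (w e)
    by_cases hb : IsBlack G w I (w e)
    · have hm : ¬ IsMinCrossed ends G w I (w e) := fun h => h.1 hb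
      have htp : ¬ IsTop ends G w I e := fun h => h.1 hb
      have hp : potential ends G w I t (w e) = 5 - t := if_pos (Or.inl hb)
      simp only [if_pos hb, if_neg hm, if_neg htp, hp]
      split_ifs <;> linarith
    · by_cases hbp : IsBlack G w I (parent ends w I e)
      · simp only [if_neg hb, if_pos hbp]
        by_cases hx : IsCrossed G (w e)
        · rw [if_pos (show IsTop ends G w I e from ⟨hb, hx, hbp⟩)]
          split_ifs <;> linarith
        · have hp : potential ends G w I t (w e) = 5 - t := if_pos (Or.inr hx)
          have hwe : ¬ HasWhiteEnd ends G w I e := by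
            rintro ⟨C, hC, h | h⟩
            · exact hx ⟨C, hC, T.cross_of_inner_mem hC he h.1 hb⟩
            · exact h.2.2 hbp
          rw [whiteCharge_eq_zero hwe, hp, if_neg (fun h : IsTop ends G w I e => hx h.2.1)]
          split_ifs <;> linarith
      · have htp : ¬ IsTop ends G w I e := fun h => hbp h.2.2
        simp only [if_neg hb, if_neg hbp, if_neg htp]
        split_ifs <;> linarith
  push_cast
  refine (Finset.sum_le_sum hedge).trans ?_
  simp only [Finset.sum_sub_distrib, Finset.sum_add_distrib, ← Finset.mul_sum, Finset.sum_boole]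
    at h1 ⊢
  nlinarith

end WitnessTree

/-- The average degree of the cores with respect to a minimal cover. -/
theorem sum_degree_le_of_minimal_cover
    (hG : IsPliable G) (hI : IsCover ends G I) (hmin : ∀ e ∈ I, ∃ S, IsWitness ends G I e S)
    (hγ : ∀ S₁ ∈ G, ∀ S₂ ∈ G, S₁ ⊂ S₂ → ∀ C, IsCore G C → Cross C S₁ → Cross C S₂ →
      S₂ \ (S₁ ∪ C) = ∅ ∨ S₂ \ (S₁ ∪ C) ∈ G)
    (hsp : ∀ S ∈ G, ∀ C₁ C₂, IsCore G C₁ → IsCore G C₂ → Cross C₁ S → Cross C₂ S → C₁ = C₂)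
    (ht0 : 0 ≤ t) (ht1 : t ≤ 1)
    (hβ : ∀ C, IsCore G C → ∀ D : Finset (Finset V), (∀ S ∈ D, S ∈ G ∧ Cross C S) →
      (∀ S ∈ D, ∀ S' ∈ D, S ≠ S' → Disjoint S S') → t * D.card ≤ 1)
    {Cs : Finset (Finset V)} (hCs : ∀ C, C ∈ Cs ↔ IsCore G C) :
    ((∑ e ∈ I, (Cs.filter fun C => Covers ends e C).card : ℕ) : ℝ) ≤ (6 - t) * Cs.card := by
  obtain ⟨w, hw, hlam⟩ := exists_laminar_witnesses hG hI hmin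
  exact (WitnessTree.mk hG hw hlam).sum_degree_le hγ hsp ht0 ht1 hβ hCs

end Charging

/-! ### Values and step counts of the subroutines -/

section TimedLemmas

variable {α β : Type}

@[simp] theorem Timed.val_bind (x : Timed α) (f : α → Timed β) :
    (x >>= f).val = (f x.val).val := rfl

@[simp] theorem Timed.time_bind (x : Timed α) (f : α → Timed β) :
    (x >>= f).time = x.time + (f x.val).time := rfl

@[simp] theorem Timed.val_pure (a : α) : (pure a : Timed α).val = a := rfl

@[simp] theorem Timed.time_pure (a : α) : (pure a : Timed α).time = 0 := rfl

@[simp] theorem time_tick (k : ℕ) : (tick k).time = k := rfl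

end TimedLemmas

section Subroutines

variable {V E : Type} [DecidableEq V] (ends : E → V × V)

/-- The number of sets in the list that `e` covers. -/
def coveredCount (Cs : List (Finset V)) (e : E) : ℕ :=
  Cs.countP fun C => decide (Covers ends e C)

theorem countCovered_val (e : E) (Cs : List (Finset V)) :
    (countCovered ends e Cs).val = coveredCount ends Cs e := by
  induction Cs with
  | nil => simp [countCovered, coveredCount]
  | cons C l ih =>
    unfold coveredCount at *
    by_cases h : Covers ends e C <;> simp [countCovered, ih, h]

theorem coveredCount_eq_card {Cs : List (Finset V)} (h : Cs.Nodup) (e : E) :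
    coveredCount ends Cs e = (Cs.toFinset.filter fun C => Covers ends e C).card := by
  rw [coveredCount, List.countP_eq_length_filter, ← List.toFinset_card_of_nodup (h.filter _)]
  congr 1
  ext
  simp

theorem length_le_sum_coveredCount {ends} {Cs : List (Finset V)} (h : Cs.Nodup) {J : Finset E}
    (hJ : ∀ C ∈ Cs, ∃ e ∈ J, Covers ends e C) : Cs.length ≤ ∑ e ∈ J, coveredCount ends Cs e := by
  simp only [coveredCount_eq_card ends h]
  rw [← List.toFinset_card_of_nodup h]
  refine le_trans ?_ (Finset.sum_card_bipartiteAbove_eq_sum_card_bipartiteBelow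
    (s := J) (t := Cs.toFinset) (fun e C => Covers ends e C)).ge
  rw [Finset.card_eq_sum_ones]
  refine Finset.sum_le_sum fun C hC => Finset.card_pos.2 ?_
  obtain ⟨e, he, hec⟩ := hJ C (List.mem_toFinset.1 hC)
  exact ⟨e, Finset.mem_filter.2 ⟨he, hec⟩⟩

theorem countCovered_time (e : E) (Cs : List (Finset V)) :
    (countCovered ends e Cs).time = 5 * Cs.length + 1 := by
  induction Cs with
  | nil => simp [countCovered]
  | cons C l ih =>
    simp only [countCovered, Timed.time_bind, time_tick, ih, Timed.time_pure, List.length_cons]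
    ring

theorem annotate_val {K : Type} (Cs : List (Finset V)) (s : E → K) (l : List E) :
    (annotate ends Cs (l.map fun e => (e, s e))).val =
      l.map fun e => (e, s e, coveredCount ends Cs e) := by
  induction l with
  | nil => simp [annotate]
  | cons e l ih => simp [annotate, ih, countCovered_val]

theorem annotate_time {K : Type} (Cs : List (Finset V)) (p : List (E × K)) :
    (annotate ends Cs p).time = p.length * (5 * Cs.length + 3) + 1 := by
  induction p with
  | nil => simp [annotate]
  | cons e l ih =>
    simp only [annotate, Timed.time_bind, time_tick, ih, countCovered_time, Timed.time_pure,
      List.length_cons]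
    ring

omit [DecidableEq V]

theorem firstTight_time (p : List (E × ℝ × ℕ)) : (firstTight p).time = 5 * p.length + 1 := by
  induction p with
  | nil => simp [firstTight]
  | cons a l ih =>
    obtain ⟨e, s, k⟩ := a
    have : ∀ x : Timed (Option (E × ℝ)), x.time = 0 →
        5 + (5 * l.length + 1 + x.time) = 5 * (l.length + 1) + 1 := fun x hx => by omega
    simp only [firstTight, Timed.time_bind, time_tick, ih, List.length_cons]
    apply this
    split_ifs
    · rfl
    · split
      · rfl
      · rfl

theorem firstTight_val (s : E → ℝ) (k : E → ℕ) (l : List E) :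
    match (firstTight (l.map fun e => (e, s e, k e))).val with
    | none => ∀ e ∈ l, k e = 0
    | some (f, ε) => f ∈ l ∧ k f ≠ 0 ∧ ε = s f / k f ∧ ∀ e ∈ l, k e ≠ 0 → ε ≤ s e / k e := by
  induction l with
  | nil => simp [firstTight]
  | cons a l ih =>
    simp only [List.map_cons, firstTight, Timed.val_bind]
    by_cases hk : k a = 0
    · rw [if_pos hk]
      simp only [Timed.val_pure]
      rcases h : (firstTight (l.map fun e => (e, s e, k e))).val with _ | ⟨f, ε⟩
      · rw [h] at ih
        simpa [hk] using ih
      · rw [h] at ih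
        simp only at ih ⊢
        refine ⟨List.mem_cons_of_mem _ ih.1, ih.2.1, ih.2.2.1, fun e he hke => ?_⟩
        rcases List.mem_cons.1 he with rfl | he
        · exact absurd hk hke
        · exact ih.2.2.2 e he hke
    · rw [if_neg hk]
      rcases h : (firstTight (l.map fun e => (e, s e, k e))).val with _ | ⟨f, ε⟩
      · rw [h] at ih
        simp only [Timed.val_pure] at ih ⊢
        refine ⟨by simp, hk, trivial, fun e he hke => ?_⟩
        rcases List.mem_cons.1 he with rfl | he
        · exact le_rfl
        · exact absurd (ih e he) hke
      · rw [h] at ih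
        simp only [Timed.val_pure] at ih ⊢
        by_cases hle : s a / k a ≤ ε
        · simp only [if_pos hle]
          refine ⟨by simp, hk, trivial, fun e he hke => ?_⟩
          rcases List.mem_cons.1 he with rfl | he
          · exact le_rfl
          · exact hle.trans (ih.2.2.2 e he hke)
        · simp only [if_neg hle]
          refine ⟨List.mem_cons_of_mem _ ih.1, ih.2.1, ih.2.2.1, fun e he hke => ?_⟩
          rcases List.mem_cons.1 he with rfl | he
          · exact (not_le.1 hle).le
          · exact ih.2.2.2 e he hke

theorem raise_val [DecidableEq E] (f : E) (ε : ℝ) (s : E → ℝ) (k : E → ℕ) (l : List E) :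
    (raise f ε (l.map fun e => (e, s e, k e))).val =
      (l.filter fun e => e ≠ f).map fun e => (e, s e - ε * k e) := by
  induction l with
  | nil => simp [raise]
  | cons e l ih =>
    by_cases h : e = f
    · subst h
      simpa [raise] using ih
    · simpa [raise, h] using ih

theorem raise_time [DecidableEq E] (f : E) (ε : ℝ) (p : List (E × ℝ × ℕ)) :
    (raise f ε p).time = 5 * p.length + 1 := by
  induction p with
  | nil => simp [raise]
  | cons a l ih =>
    obtain ⟨e, s, k⟩ := a
    simp only [raise, Timed.time_bind, time_tick, ih, Timed.time_pure, List.length_cons]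
    ring

end Subroutines

/-! ### Core queries -/

section Oracle

variable {V E : Type} [Fintype V] [DecidableEq V] {ends : E → V × V}
  {F : Set (Finset V)} {cores : Finset E → List (Finset V)}

theorem IsCoreOracle.eq_nil_iff (hor : IsCoreOracle ends F cores) (J : Finset E) :
    cores J = [] ↔ IsCover ends F J := by
  constructor
  · intro h S hS
    by_contra hcon
    push Not at hcon
    obtain ⟨C, hC, -⟩ := exists_isCore_subset (G := residual ends F J) ⟨hS, hcon⟩
    have := ((hor J).2 C).2 hC
    simp [h] at this
  · intro h
    rw [List.eq_nil_iff_forall_not_mem]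
    intro C hC
    obtain ⟨hCF, hCJ⟩ := (((hor J).2 C).1 hC).1
    obtain ⟨e, he, hec⟩ := h C hCF
    exact hCJ e he hec

theorem IsCoreOracle.length_le (hF : IsPliable F) (hor : IsCoreOracle ends F cores)
    (J : Finset E) : (cores J).length ≤ Fintype.card V := by
  have hG := hF.residual (ends := ends) J
  rw [← List.toFinset_card_of_nodup (hor J).1]
  refine (Finset.card_le_card_biUnion (f := id) ?_ ?_).trans (Finset.card_le_univ _)
  · intro C hC D hD hne
    rw [Finset.mem_coe, List.mem_toFinset, (hor J).2] at hC hD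
    exact hC.disjoint hG hD hne
  · intro C hC
    rw [List.mem_toFinset, (hor J).2] at hC
    exact Finset.nonempty_iff_ne_empty.2 fun h => hG.1 (h ▸ hC.1)

/-- The degree bound for the minimal covers of all residual families, in the form in which the
analysis of the first phase uses it. -/
theorem sum_coveredCount_le (hF : IsGammaPliable ends F) (hsp : IsSparse ends F)
    (hor : IsCoreOracle ends F cores) {t : ℝ} (ht0 : 0 ≤ t) (ht1 : t ≤ 1)
    (hβ : ∀ J : Finset E, ∀ C, IsCore (residual ends F J) C → ∀ D : Finset (Finset V),
      (∀ S ∈ D, S ∈ residual ends F J ∧ Cross C S) →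
      (∀ S ∈ D, ∀ S' ∈ D, S ≠ S' → Disjoint S S') → t * D.card ≤ 1)
    (J I : Finset E) (hI : IsCover ends (residual ends F J) I)
    (hmin : ∀ e ∈ I, ∃ S, IsWitness ends (residual ends F J) I e S) :
    ((∑ e ∈ I, coveredCount ends (cores J) e : ℕ) : ℝ) ≤ (6 - t) * (cores J).length := by
  simp only [coveredCount_eq_card ends (hor J).1]
  rw [← List.toFinset_card_of_nodup (hor J).1]
  refine sum_degree_le_of_minimal_cover (hF.1.residual J) hI hmin (hF.2 J) ?_ ht0 ht1 (hβ J)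
    (fun C => List.mem_toFinset.trans ((hor J).2 C))
  intro S hS C₁ C₂ h₁ h₂ hx₁ hx₂
  exact hsp J S hS C₁ C₂ h₁ h₂ hx₁.symm hx₂.symm

end Oracle

/-! ### The two phases of the algorithm -/

section Phases

variable {V E : Type} [Fintype V] [DecidableEq V] [Fintype E] [DecidableEq E] {ends : E → V × V}
  {F : Set (Finset V)} {cores : Finset E → List (Finset V)}

/-- What reverse delete achieves for the list `L` of edges, latest first: each edge of `X` is
needed even if all edges added before it are present. -/
def IsReverseMinimal (ends : E → V × V) (F : Set (Finset V)) (X : Finset E) (L : List E) : Prop :=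
  ∀ A e B, L = A ++ e :: B → e ∈ X →
    ∃ S ∈ F, (∀ g ∈ B, ¬ Covers ends g S) ∧ ∀ g ∈ X, g ≠ e → ¬ Covers ends g S

theorem phase2_spec (hor : IsCoreOracle ends F cores) (τ : ℕ) (todo : List E) :
    ∀ kept : List E, (kept ++ todo).Nodup → IsCover ends F (kept ++ todo).toFinset →
      (phase2 cores τ todo kept).val ⊆ kept ++ todo ∧
      IsCover ends F (phase2 cores τ todo kept).val.toFinset ∧
      IsReverseMinimal ends F (phase2 cores τ todo kept).val.toFinset todo ∧
      (phase2 cores τ todo kept).time ≤ todo.length * (Fintype.card E + τ + 3) := by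
  induction todo with
  | nil =>
    intro kept _ hcov
    simp only [List.append_nil] at hcov
    refine ⟨by simp [phase2], by simpa [phase2] using hcov, ?_, by simp [phase2]⟩
    intro A e B h
    simp at h
  | cons e todo ih =>
    intro kept hnd hcov
    have hperm : (kept ++ e :: todo).Perm (e :: kept ++ todo) := List.perm_middle
    have hnd1 : (e :: kept ++ todo).Nodup := hperm.nodup_iff.1 hnd
    have hnd2 : (kept ++ todo).Nodup := (List.nodup_cons.1 hnd1).2
    have he : e ∉ kept ++ todo := (List.nodup_cons.1 hnd1).1
    have hlen : (kept ++ todo).length ≤ Fintype.card E := hnd2.length_le_card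
    by_cases hc : cores (kept ++ todo).toFinset = []
    · have hval : (phase2 cores τ (e :: todo) kept).val = (phase2 cores τ todo kept).val := by
        simp [phase2, query, hc, -List.toFinset_append]
      have htime : (phase2 cores τ (e :: todo) kept).time =
          (kept ++ todo).length + τ + 3 + (phase2 cores τ todo kept).time := by
        simp [phase2, query, hc, -List.toFinset_append]
        ring
      obtain ⟨h1, h2, h3, h4⟩ := ih kept hnd2 ((hor.eq_nil_iff _).1 hc)
      rw [hval, htime]
      refine ⟨fun x hx => hperm.mem_iff.2 (List.mem_cons_of_mem e (h1 hx)), h2, ?_, ?_⟩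
      · rintro A f B hAB hf
        rcases List.cons_eq_append_iff.1 hAB with ⟨rfl, hfB⟩ | ⟨A', rfl, hA'⟩
        · obtain ⟨rfl, rfl⟩ := List.cons.inj hfB
          exact absurd (h1 (List.mem_toFinset.1 hf)) he
        · exact h3 A' f B hA' hf
      · rw [List.length_cons, add_mul, one_mul]
        omega
    · have hval : (phase2 cores τ (e :: todo) kept).val =
          (phase2 cores τ todo (e :: kept)).val := by
        simp [phase2, query, hc, -List.toFinset_append]
      have htime : (phase2 cores τ (e :: todo) kept).time =
          (kept ++ todo).length + τ + 3 + (phase2 cores τ todo (e :: kept)).time := by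
        simp [phase2, query, hc, -List.toFinset_append]
        ring
      obtain ⟨h1, h2, h3, h4⟩ := ih (e :: kept) hnd1
        (by rwa [← List.toFinset_eq_of_perm _ _ hperm])
      rw [hval, htime]
      refine ⟨fun x hx => hperm.mem_iff.2 (h1 hx), h2, ?_, ?_⟩
      · rintro A f B hAB hf
        rcases List.cons_eq_append_iff.1 hAB with ⟨rfl, hfB⟩ | ⟨A', rfl, hA'⟩
        · obtain ⟨rfl, rfl⟩ := List.cons.inj hfB
          rw [hor.eq_nil_iff] at hc
          unfold IsCover at hc
          push Not at hc
          obtain ⟨S, hS, hSn⟩ := hc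
          refine ⟨S, hS, fun g hg => hSn g (by simp [hg]), fun g hg hgf => hSn g ?_⟩
          have := h1 (List.mem_toFinset.1 hg)
          rw [List.cons_append, List.mem_cons] at this
          exact List.mem_toFinset.2 (this.resolve_left hgf)
        · exact h3 A' f B hA' hf
      · rw [List.length_cons, add_mul, one_mul]
        omega

/-- The weak duality step, in the form of a local ratio argument: `s` is the slack left when the
edges `J` have been picked, and each round splits off from it the part `ε * coveredCount`, for which
every cover pays at least `ε` per core and a reverse minimal one at most `ρ * ε`. -/
theorem phase1_spec (hF : IsPliable F) (hor : IsCoreOracle ends F cores)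
    (hE : IsCover ends F Finset.univ) (τ : ℕ) {ρ : ℝ} (hρ : 0 ≤ ρ)
    (hdeg : ∀ J I : Finset E, IsCover ends (residual ends F J) I →
      (∀ e ∈ I, ∃ S, IsWitness ends (residual ends F J) I e S) →
      ((∑ e ∈ I, coveredCount ends (cores J) e : ℕ) : ℝ) ≤ ρ * (cores J).length) (fuel : ℕ) :
    ∀ (J l : List E) (s : E → ℝ), J.Nodup → l.Nodup → (∀ e, e ∈ l ↔ e ∉ J) → l.length ≤ fuel →
      (∀ e ∈ l, 0 ≤ s e) →
      (∃ A, (phase1 ends cores τ fuel J (l.map fun e => (e, s e))).val = A ++ J) ∧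
      (phase1 ends cores τ fuel J (l.map fun e => (e, s e))).val.Nodup ∧
      IsCover ends F (phase1 ends cores τ fuel J (l.map fun e => (e, s e))).val.toFinset ∧
      (phase1 ends cores τ fuel J (l.map fun e => (e, s e))).time ≤
        fuel * (5 * Fintype.card E * Fintype.card V + 14 * Fintype.card E + τ + 6) ∧
      ∀ X : Finset E, X ⊆ (phase1 ends cores τ fuel J (l.map fun e => (e, s e))).val.toFinset →
        IsCover ends F X →
        IsReverseMinimal ends F X (phase1 ends cores τ fuel J (l.map fun e => (e, s e))).val →
        ∀ J' : Finset E, IsCover ends F J' →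
          ∑ e ∈ X \ J.toFinset, s e ≤ ρ * ∑ e ∈ J' \ J.toFinset, s e := by
  have hdone : ∀ (J l : List E) (s : E → ℝ), (∀ e, e ∈ l ↔ e ∉ J) → (∀ e ∈ l, 0 ≤ s e) →
      ∀ X : Finset E, X ⊆ J.toFinset → ∀ J' : Finset E,
        ∑ e ∈ X \ J.toFinset, s e ≤ ρ * ∑ e ∈ J' \ J.toFinset, s e := by
    intro J l s hl hs X hX J'
    rw [Finset.sdiff_eq_empty_iff_subset.2 hX, Finset.sum_empty]
    refine mul_nonneg hρ (Finset.sum_nonneg fun e he => hs e ((hl e).2 ?_))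
    simpa using (Finset.mem_sdiff.1 he).2
  induction fuel with
  | zero =>
    intro J l s hJ _ hl hlen hs
    have hl0 : l = [] := List.length_eq_zero_iff.1 (Nat.le_zero.1 hlen)
    subst hl0
    have hJu : J.toFinset = Finset.univ := by
      ext e
      simpa using not_not.1 (mt (hl e).2 (by simp))
    simp only [phase1, Timed.val_pure, Timed.time_pure]
    exact ⟨⟨[], rfl⟩, hJ, hJu ▸ hE, by simp, fun X hX _ _ J' _ => hdone J [] s hl hs X hX J'⟩
  | succ fuel ih =>
    intro J l s hJ hlnd hl hlen hs
    set Cs := cores J.toFinset with hCs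
    have hJm : J.length ≤ Fintype.card E := hJ.length_le_card
    have hlm : l.length ≤ Fintype.card E := hlnd.length_le_card
    by_cases hnil : Cs = []
    · have hval : (phase1 ends cores τ (fuel + 1) J (l.map fun e => (e, s e))).val = J := by
        simp [phase1, query, ← hCs, hnil]
      have htime : (phase1 ends cores τ (fuel + 1) J (l.map fun e => (e, s e))).time =
          J.length + τ + 3 := by
        simp [phase1, query, ← hCs, hnil]
      rw [hval, htime]
      refine ⟨⟨[], rfl⟩, hJ, (hor.eq_nil_iff _).1 hnil, ?_,
        fun X hX _ _ J' _ => hdone J l s hl hs X hX J'⟩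
      rw [add_mul, one_mul]
      have : 0 ≤ fuel * (5 * Fintype.card E * Fintype.card V + 14 * Fintype.card E + τ + 6) :=
        Nat.zero_le _
      have : 0 ≤ 5 * Fintype.card E * Fintype.card V := Nat.zero_le _
      omega
    · have hft := firstTight_val s (coveredCount ends Cs) l
      rcases hfst : (firstTight (l.map fun e => (e, s e, coveredCount ends Cs e))).val with
        _ | ⟨f, ε⟩
      · -- some core exists, and the edge covering it is still in the pool
        exfalso
        rw [hfst] at hft
        obtain ⟨C, hC⟩ := List.exists_mem_of_ne_nil _ hnil
        obtain ⟨hCF, hCJ⟩ := (((hor _).2 C).1 hC).1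
        obtain ⟨e, -, heC⟩ := hE C hCF
        have hel : e ∈ l := (hl e).2 fun h => hCJ e (by simpa using h) heC
        have := hft e hel
        rw [coveredCount, List.countP_eq_zero] at this
        exact this C hC (by simpa using heC)
      · rw [hfst] at hft
        obtain ⟨hfl, hkf, hε, hmin⟩ := hft
        set s' : E → ℝ := fun e => s e - ε * coveredCount ends Cs e with hs'def
        set l' := l.filter fun e => e ≠ f with hl'
        have hstep : (phase1 ends cores τ (fuel + 1) J (l.map fun e => (e, s e))).val =
            (phase1 ends cores τ fuel (f :: J) (l'.map fun e => (e, s' e))).val := by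
          simp [phase1, query, ← hCs, hnil, annotate_val, hfst, raise_val, hl', hs'def]
        have htime : (phase1 ends cores τ (fuel + 1) J (l.map fun e => (e, s e))).time =
            J.length + τ + 3 + (l.length * (5 * Cs.length + 3) + 1) + 2 * (5 * l.length + 1) +
            (phase1 ends cores τ fuel (f :: J) (l'.map fun e => (e, s' e))).time := by
          simp [phase1, query, ← hCs, hnil, annotate_val, annotate_time, firstTight_time,
            raise_time, hfst, raise_val, hl', hs'def]
          ring
        have hkpos : (0 : ℝ) < coveredCount ends Cs f := by
          exact_mod_cast Nat.pos_of_ne_zero hkf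
        have hε0 : 0 ≤ ε := hε ▸ div_nonneg (hs f hfl) hkpos.le
        have hs'f : s' f = 0 := by
          simp only [hs'def, hε]
          field_simp
          ring
        have hs'0 : ∀ e ∈ l, 0 ≤ s' e := by
          intro e he
          by_cases hk : coveredCount ends Cs e = 0
          · simpa [hs'def, hk] using hs e he
          · have hpos : (0 : ℝ) < coveredCount ends Cs e := by
              exact_mod_cast Nat.pos_of_ne_zero hk
            have := (le_div_iff₀ hpos).1 (hmin e he hk)
            simpa [hs'def] using this
        have hfJ : f ∉ J := (hl f).1 hfl
        have hlen' : l'.length ≤ fuel := by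
          have : l'.length < l.length := List.length_filter_lt_length_iff_exists.2 ⟨f, hfl, by simp⟩
          omega
        obtain ⟨⟨A, hA⟩, h2, h3, h4, h5⟩ := ih (f :: J) l' s' (List.nodup_cons.2 ⟨hfJ, hJ⟩)
          (hlnd.filter _) (fun e => by simp [hl', hl e]; tauto) hlen'
          (fun e he => hs'0 e (List.mem_of_mem_filter he))
        rw [hstep, htime]
        refine ⟨⟨A ++ [f], by simp [hA]⟩, h2, h3, ?_, ?_⟩
        · have hCl : Cs.length ≤ Fintype.card V := hor.length_le hF _
          have : l.length * (5 * Cs.length + 3) ≤ Fintype.card E * (5 * Fintype.card V + 3) := by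
            gcongr
          have h6 : Fintype.card E * (5 * Fintype.card V + 3) =
            5 * Fintype.card E * Fintype.card V + 3 * Fintype.card E := by ring
          rw [add_mul, one_mul]
          omega
        · intro X hX hXc hXmin J' hJ'
          have hrec := h5 X hX hXc hXmin J' hJ'
          set I := X \ J.toFinset with hI
          -- the edge `f` has slack `0` after the raise
          have herase : ∀ Y : Finset E, ∑ e ∈ Y \ (f :: J).toFinset, s' e =
              ∑ e ∈ Y \ J.toFinset, s' e := by
            intro Y
            refine Finset.sum_subset (fun e => by simp; tauto) fun e he hne => ?_
            have : e = f := by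
              simp at he hne
              tauto
            rw [this, hs'f]
          rw [herase, herase] at hrec
          have hIcov : IsCover ends (residual ends F J.toFinset) I := by
            intro S hS
            obtain ⟨e, he, hec⟩ := hXc S hS.1
            exact ⟨e, Finset.mem_sdiff.2 ⟨he, fun h => hS.2 e h hec⟩, hec⟩
          have hIwit : ∀ e ∈ I, ∃ S, IsWitness ends (residual ends F J.toFinset) I e S := by
            intro e he
            obtain ⟨heX, heJ⟩ := Finset.mem_sdiff.1 he
            have hmem := hX heX
            rw [hA, List.mem_toFinset, List.append_cons, List.mem_append] at hmem
            obtain ⟨A₁, A₂, hA12⟩ := List.append_of_mem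
              (hmem.resolve_right fun h => heJ (by simpa using h))
            obtain ⟨S, hS, hSB, hSX⟩ := hXmin A₁ e (A₂ ++ J)
              (by rw [hA, List.append_cons, hA12]; simp) heX
            refine ⟨S, ⟨hS, fun g hg => hSB g ?_⟩, fun g hg => ⟨fun h => ?_, ?_⟩⟩
            · exact List.mem_append_right _ (List.mem_toFinset.1 hg)
            · by_contra hne
              exact hSX g (Finset.mem_sdiff.1 hg).1 hne h
            · rintro rfl
              obtain ⟨g', hg', hgc⟩ := hXc S hS
              by_cases hgg : g' = g
              · exact hgg ▸ hgc
              · exact absurd hgc (hSX g' hg' hgg)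
          have hupper := hdeg J.toFinset I hIcov hIwit
          rw [← hCs] at hupper
          have hlower : (Cs.length : ℝ) ≤
              ((∑ e ∈ J' \ J.toFinset, coveredCount ends Cs e : ℕ) : ℝ) := by
            exact_mod_cast length_le_sum_coveredCount (ends := ends) (Cs := Cs)
              (J := J' \ J.toFinset) (hor _).1 fun C hC => by
              obtain ⟨hCF, hCJ⟩ := (((hor _).2 C).1 hC).1
              obtain ⟨e, he, hec⟩ := hJ' C hCF
              exact ⟨e, Finset.mem_sdiff.2 ⟨he, fun h => hCJ e h hec⟩, hec⟩
          have hsplit : ∀ Y : Finset E, ∑ e ∈ Y, s e =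
              ∑ e ∈ Y, s' e + ε * ((∑ e ∈ Y, coveredCount ends Cs e : ℕ) : ℝ) := by
            intro Y
            push_cast
            rw [Finset.mul_sum, ← Finset.sum_add_distrib]
            exact Finset.sum_congr rfl fun e _ => by simp [hs'def]
          rw [hsplit, hsplit]
          have h6 := mul_le_mul_of_nonneg_left hupper hε0
          have h7 := mul_le_mul_of_nonneg_left hlower (mul_nonneg hρ hε0)
          nlinarith

theorem wgmv_spec (hF : IsPliable F) (hor : IsCoreOracle ends F cores)
    (hE : IsCover ends F Finset.univ) (τ : ℕ) {ρ : ℝ} (hρ : 0 ≤ ρ)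
    (hdeg : ∀ J I : Finset E, IsCover ends (residual ends F J) I →
      (∀ e ∈ I, ∃ S, IsWitness ends (residual ends F J) I e S) →
      ((∑ e ∈ I, coveredCount ends (cores J) e : ℕ) : ℝ) ≤ ρ * (cores J).length)
    {c : E → ℝ} (hc : ∀ e, 0 ≤ c e) {es : List E} (hnd : es.Nodup) (hes : ∀ e, e ∈ es) :
    IsApproxSolution ends c F ρ (wgmv ends c cores τ es).val.toFinset ∧
      (wgmv ends c cores τ es).time ≤ 2 * Fintype.card E + 1 +
        Fintype.card E * (5 * Fintype.card E * Fintype.card V + 14 * Fintype.card E + τ + 6) +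
        Fintype.card E * (Fintype.card E + τ + 3) := by
  have hlen : es.length ≤ Fintype.card E := hnd.length_le_card
  obtain ⟨-, h2, h3, h4, h5⟩ := phase1_spec hF hor hE τ hρ hdeg es.length [] es c List.nodup_nil
    hnd (by simpa using hes) le_rfl (fun e _ => hc e)
  set P := phase1 ends cores τ es.length [] (es.map fun e => (e, c e)) with hP
  obtain ⟨h6, h7, h8, h9⟩ := phase2_spec hor τ P.val [] (by simpa using h2) (by simpa using h3)
  have hval : (wgmv ends c cores τ es).val = (phase2 cores τ P.val []).val := rfl
  have htime : (wgmv ends c cores τ es).time =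
      2 * es.length + 1 + (P.time + (phase2 cores τ P.val []).time) := rfl
  rw [hval, htime]
  refine ⟨⟨h7, fun J' hJ' => ?_⟩, ?_⟩
  · have := h5 _ (fun e he => ?_) h7 h8 J' hJ'
    · simpa using this
    · simpa using h6 (List.mem_toFinset.1 he)
  · have hPlen : P.val.length ≤ Fintype.card E := h2.length_le_card
    have h10 := h4.trans (Nat.mul_le_mul_right _ hlen)
    have h11 := h9.trans (Nat.mul_le_mul_right _ hPlen)
    omega

end Phases

end SetFamilyCover

theorem theorem2 :
    ∃ P : Polynomial ℕ,
      ∀ (V E : Type) [Fintype V] [DecidableEq V] [Fintype E] [DecidableEq E]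
        (ends : E → V × V) (c : E → ℝ) (F : Set (Finset V))
        (cores : Finset E → List (Finset V)) (τ : ℕ) (es : List E),
        (∀ e, 0 ≤ c e) →
        IsCover ends F Finset.univ →
        IsGammaPliable ends F →
        IsSparse ends F →
        IsCoreOracle ends F cores →
        es.Nodup → (∀ e, e ∈ es) →
        IsApproxSolution ends c F 6 (wgmv ends c cores τ es).val.toFinset ∧
        (∀ β : ℕ, 1 ≤ β → IsBetaCrossing ends F β →
          IsApproxSolution ends c F (6 - 1 / ((β : ℝ) + 1))
            (wgmv ends c cores τ es).val.toFinset) ∧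
        (wgmv ends c cores τ es).time ≤
          P.eval (Fintype.card V + Fintype.card E + τ) := by
  refine ⟨5 * Polynomial.X ^ 3 + 17 * Polynomial.X ^ 2 + 11 * Polynomial.X + 1, ?_⟩
  intro V E _ _ _ _ ends c F cores τ es hc hE hF hsp hor hnd hes
  have h6 := wgmv_spec hF.1 hor hE τ (ρ := 6) (by norm_num)
    (fun J I hI hmin => by
      simpa using sum_coveredCount_le hF hsp hor le_rfl zero_le_one
        (fun _ _ _ D _ _ => by simp) J I hI hmin) hc hnd hes
  refine ⟨h6.1, fun β _ hβ => ?_, h6.2.trans ?_⟩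
  · have hpos : (0 : ℝ) < β + 1 := by positivity
    have ht1 : 1 / ((β : ℝ) + 1) ≤ 1 := by
      rw [div_le_one hpos]
      linarith [(Nat.cast_nonneg β : (0 : ℝ) ≤ β)]
    refine (wgmv_spec hF.1 hor hE τ (by linarith)
      (sum_coveredCount_le hF hsp hor (by positivity) ht1 fun J C hC D h1 h2 => ?_)
      hc hnd hes).1
    rw [one_div, inv_mul_le_one₀ hpos]
    have : (D.card : ℝ) ≤ β := by exact_mod_cast hβ J C hC D h1 h2
    linarith
  · simp only [Polynomial.eval_add, Polynomial.eval_mul, Polynomial.eval_pow, Polynomial.eval_X,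
      Polynomial.eval_one, Polynomial.eval_ofNat]
    set n := Fintype.card V + Fintype.card E + τ with hn
    have h1 : Fintype.card E ≤ n := by omega
    have h2 : Fintype.card V ≤ n := by omega
    have h3 : τ ≤ n := by omega
    calc _ ≤ 2 * n + 1 + n * (5 * n * n + 14 * n + n + 6) + n * (n + n + 3) := by gcongr
      _ = _ := by ring
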